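/- The diamond graphs $\{D_n\}_{n\ge 0}$ are defined recursively: $D_0$ is a single edge, and $D_n$ is obtained from $D_{n-1}$ by replacing each edge $uv$ by a quadrilateral $u,a,v,b$ with edges $ua, av, vb, bu$, where $a,b$ are new vertices. The Laakso graphs $\{L_n\}_{n\ge 0}$ are defined recursively: $L_0$ is a single edge, $L_1$ is the graph with vertices $u,p,c,d,q,v$ and edges $up, pc, pd, cq, dq, qv$, and $L_n$ is obtained from $L_{n-1}$ by replacing each edge by a copy of $L_1$, the ends of the edge being identified with the two vertices of degree $1$ of $L_1$. The vertex sets carry the shortest path metrics, where either all edges have length $1$ (unweighted graphs), or the edges of $D_n$ have length $2^{-n}$, respectively those of $L_n$ have length $4^{-n}$ (weighted graphs). For $1\le C<\infty$, a map $f:A\to Y$ between metric spaces is a $C$-bilipschitz embedding if there is $r>0$ such that $r\,d_A(u,v)\le d_Y(f(u),f(v))\le rC\,d_A(u,v)$ for all $u,v\in A$; the smallest such $C$ is the distortion of $f$. A sequence $\{M_n\}$ of metric spaces admits uniformly bilipschitz embeddings into a sequence $\{R_n\}$ if for each $n$ there are an index $m(n)$ and a bilipschitz embedding $f_n:M_n\to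 R_{m(n)}$ such that the distortions of $\{f_n\}$ are uniformly bounded. **Theorem.** The sequence $\{L_n\}$ of Laakso graphs does not admit uniformly bilipschitz embeddings into the sequence $\{D_n\}$ of diamond graphs. This holds for each of the two normalizations (weighted or unweighted) of either sequence. -/

import Mathlib

/-! ### Graphs given by edges with a (fixed but irrelevant) orientation, and edge replacement -/

/-- A graph given by a vertex set, an edge set and the two ends of every edge.  The order of the
two ends is used only to say which copy of an end is which when an edge is replaced. -/
structure EdgeGraph where
  /-- The vertices. -/
  V : Type
  /-- The edges. -/
  E : Type
  /-- The first end of an edge. -/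
  src : E → V
  /-- The second end of an edge. -/
  tgt : E → V

namespace EdgeGraph

/-- The underlying undirected simple graph. -/
def toSimpleGraph (G : EdgeGraph) : SimpleGraph G.V :=
  SimpleGraph.fromRel (fun u v => ∃ e : G.E, G.src e = u ∧ G.tgt e = v)

theorem reachable_ends (G : EdgeGraph) (e : G.E) :
    G.toSimpleGraph.Reachable (G.src e) (G.tgt e) := by
  by_cases h : G.src e = G.tgt e
  · rw [h]
  · refine SimpleGraph.Adj.reachable ?_
    exact (SimpleGraph.fromRel_adj _ _ _).2 ⟨h, Or.inl ⟨e, rfl, rfl⟩⟩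

/-- A map of vertices that sends the ends of every edge to mutually reachable vertices preserves
reachability. -/
theorem reachable_map (G : EdgeGraph) {V' : Type} (H : SimpleGraph V') (φ : G.V → V')
    (hφ : ∀ e, H.Reachable (φ (G.src e)) (φ (G.tgt e))) {u v : G.V}
    (h : G.toSimpleGraph.Reachable u v) : H.Reachable (φ u) (φ v) := by
  obtain ⟨p⟩ := h
  induction p with
  | nil => exact SimpleGraph.Reachable.refl _
  | cons hadj _ ih =>
    refine SimpleGraph.Reachable.trans ?_ ih
    rcases ((SimpleGraph.fromRel_adj _ _ _).1 hadj).2 with ⟨e, rfl, rfl⟩ | ⟨e, rfl, rfl⟩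
    · exact hφ e
    · exact (hφ e).symm

end EdgeGraph

/-- The vertices of a graph with two distinguished vertices (`first` and `second`), the others
being indexed by `W`. -/
inductive GadgetVertex (W : Type) : Type
  | first : GadgetVertex W
  | second : GadgetVertex W
  | inner (w : W) : GadgetVertex W

/-- A graph with two distinguished vertices, to be put in the place of edges. -/
structure Gadget where
  /-- The vertices other than the two distinguished ones. -/
  W : Type
  /-- The edges. -/
  F : Type
  /-- The first end of an edge. -/
  src : F → GadgetVertex W
  /-- The second end of an edge. -/
  tgt : F → GadgetVertex W

namespace Gadget

/-- The gadget as a graph. -/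
def toEdgeGraph (K : Gadget) : EdgeGraph where
  V := GadgetVertex K.W
  E := K.F
  src := K.src
  tgt := K.tgt

end Gadget

namespace EdgeGraph

/-- The vertices of the copy of the gadget that is put in the place of the edge `e = uv`:
`first` is identified with `u`, `second` with `v`, the others are new. -/
def place (G : EdgeGraph) (W : Type) (e : G.E) : GadgetVertex W → G.V ⊕ (G.E × W)
  | .first => Sum.inl (G.src e)
  | .second => Sum.inl (G.tgt e)
  | .inner w => Sum.inr (e, w)

/-- The graph obtained from `G` by replacing every edge by a copy of the gadget `K`. -/
def replaceEdges (G : EdgeGraph) (K : Gadget) : EdgeGraph where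
  V := G.V ⊕ (G.E × K.W)
  E := G.E × K.F
  src := fun p => G.place K.W p.1 (K.src p.2)
  tgt := fun p => G.place K.W p.1 (K.tgt p.2)

theorem replaceEdges_connected (G : EdgeGraph) (K : Gadget)
    (hG : G.toSimpleGraph.Connected) (hK : K.toEdgeGraph.toSimpleGraph.Connected) :
    (G.replaceEdges K).toSimpleGraph.Connected := by
  have copy : ∀ (e : G.E) (x y : GadgetVertex K.W),
      (G.replaceEdges K).toSimpleGraph.Reachable (G.place K.W e x) (G.place K.W e y) := by
    intro e x y
    exact K.toEdgeGraph.reachable_map (G.replaceEdges K).toSimpleGraph (G.place K.W e)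
      (fun f => (G.replaceEdges K).reachable_ends (e, f)) (hK.preconnected x y)
  have old : ∀ u v : G.V,
      (G.replaceEdges K).toSimpleGraph.Reachable (Sum.inl u) (Sum.inl v) := by
    intro u v
    exact G.reachable_map (G.replaceEdges K).toSimpleGraph Sum.inl
      (fun e => copy e .first .second) (hG.preconnected u v)
  have toOld : ∀ x : (G.replaceEdges K).V, ∃ u : G.V,
      (G.replaceEdges K).toSimpleGraph.Reachable x (Sum.inl u) := by
    rintro (u | ⟨e, w⟩)
    · exact ⟨u, SimpleGraph.Reachable.refl _⟩
    · exact ⟨G.src e, copy e (.inner w) .first⟩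
  obtain ⟨u₀⟩ := hG.nonempty
  have hne : Nonempty (G.replaceEdges K).V := ⟨Sum.inl u₀⟩
  refine SimpleGraph.Connected.mk ?_
  intro x y
  obtain ⟨u, hu⟩ := toOld x
  obtain ⟨v, hv⟩ := toOld y
  exact (hu.trans (old u v)).trans hv.symm

/-- Two vertices joined by an edge. -/
def singleEdge : EdgeGraph where
  V := Bool
  E := Unit
  src := fun _ => false
  tgt := fun _ => true

theorem singleEdge_connected : singleEdge.toSimpleGraph.Connected := by
  have h : singleEdge.toSimpleGraph.Reachable false true := singleEdge.reachable_ends ()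
  have hne : Nonempty singleEdge.V := ⟨false⟩
  refine SimpleGraph.Connected.mk ?_
  intro x y
  cases x <;> cases y
  · exact SimpleGraph.Reachable.refl _
  · exact h
  · exact h.symm
  · exact SimpleGraph.Reachable.refl _

end EdgeGraph

/-! ### Diamond graphs -/

/-- The two new vertices of the quadrilateral `u, a, v, b`. -/
inductive DiamondInner : Type
  | a : DiamondInner
  | b : DiamondInner

/-- The four edges of the quadrilateral `u, a, v, b`. -/
inductive DiamondEdge : Type
  | ua : DiamondEdge
  | av : DiamondEdge
  | ub : DiamondEdge
  | bv : DiamondEdge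

/-- The quadrilateral `u, a, v, b`, with distinguished vertices `u` (first) and `v` (second). -/
def diamondGadget : Gadget where
  W := DiamondInner
  F := DiamondEdge
  src := fun f => match f with
    | .ua => .first
    | .av => .inner .a
    | .ub => .first
    | .bv => .inner .b
  tgt := fun f => match f with
    | .ua => .inner .a
    | .av => .second
    | .ub => .inner .b
    | .bv => .second

/-- The diamond graph of level `n`. -/
def diamondGraph : ℕ → EdgeGraph
  | 0 => EdgeGraph.singleEdge
  | n + 1 => (diamondGraph n).replaceEdges diamondGadget

theorem diamondGadget_connected : diamondGadget.toEdgeGraph.toSimpleGraph.Connected := by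
  have h1 := diamondGadget.toEdgeGraph.reachable_ends DiamondEdge.ua
  have h2 := diamondGadget.toEdgeGraph.reachable_ends DiamondEdge.av
  have h3 := diamondGadget.toEdgeGraph.reachable_ends DiamondEdge.ub
  have key : ∀ x : GadgetVertex DiamondInner,
      diamondGadget.toEdgeGraph.toSimpleGraph.Reachable GadgetVertex.first x := by
    rintro (_ | _ | (_ | _))
    · exact SimpleGraph.Reachable.refl _
    · exact h1.trans h2
    · exact h1
    · exact h3
  have hne : Nonempty diamondGadget.toEdgeGraph.V := ⟨GadgetVertex.first⟩
  refine SimpleGraph.Connected.mk ?_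
  intro x y
  exact (key x).symm.trans (key y)

theorem diamondGraph_connected : ∀ n, (diamondGraph n).toSimpleGraph.Connected
  | 0 => EdgeGraph.singleEdge_connected
  | n + 1 => EdgeGraph.replaceEdges_connected _ _ (diamondGraph_connected n)
      diamondGadget_connected

/-! ### Laakso graphs -/

/-- The vertices of degree larger than one of the Laakso graph of level one: `p` is the neighbour
of one end, `q` the neighbour of the other, `c` and `d` lie between them. -/
inductive LaaksoInner : Type
  | p : LaaksoInner
  | c : LaaksoInner
  | d : LaaksoInner
  | q : LaaksoInner

/-- The six edges of the Laakso graph of level one with vertices of degree one `u` and `v`. -/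
inductive LaaksoEdge : Type
  | up : LaaksoEdge
  | pc : LaaksoEdge
  | pd : LaaksoEdge
  | cq : LaaksoEdge
  | dq : LaaksoEdge
  | qv : LaaksoEdge

/-- The Laakso graph of level one; its vertices of degree one are the distinguished ones. -/
def laaksoGadget : Gadget where
  W := LaaksoInner
  F := LaaksoEdge
  src := fun f => match f with
    | .up => .first
    | .pc => .inner .p
    | .pd => .inner .p
    | .cq => .inner .c
    | .dq => .inner .d
    | .qv => .inner .q
  tgt := fun f => match f with
    | .up => .inner .p
    | .pc => .inner .c
    | .pd => .inner .d
    | .cq => .inner .q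
    | .dq => .inner .q
    | .qv => .second

/-- The Laakso graph of level `n`. -/
def laaksoGraph : ℕ → EdgeGraph
  | 0 => EdgeGraph.singleEdge
  | n + 1 => (laaksoGraph n).replaceEdges laaksoGadget

theorem laaksoGadget_connected : laaksoGadget.toEdgeGraph.toSimpleGraph.Connected := by
  have h1 := laaksoGadget.toEdgeGraph.reachable_ends LaaksoEdge.up
  have h2 := laaksoGadget.toEdgeGraph.reachable_ends LaaksoEdge.pc
  have h3 := laaksoGadget.toEdgeGraph.reachable_ends LaaksoEdge.pd
  have h4 := laaksoGadget.toEdgeGraph.reachable_ends LaaksoEdge.cq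
  have h5 := laaksoGadget.toEdgeGraph.reachable_ends LaaksoEdge.qv
  have key : ∀ x : GadgetVertex LaaksoInner,
      laaksoGadget.toEdgeGraph.toSimpleGraph.Reachable GadgetVertex.first x := by
    rintro (_ | _ | (_ | _ | _ | _))
    · exact SimpleGraph.Reachable.refl _
    · exact ((h1.trans h2).trans h4).trans h5
    · exact h1
    · exact h1.trans h2
    · exact h1.trans h3
    · exact (h1.trans h2).trans h4
  have hne : Nonempty laaksoGadget.toEdgeGraph.V := ⟨GadgetVertex.first⟩
  refine SimpleGraph.Connected.mk ?_
  intro x y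
  exact (key x).symm.trans (key y)

theorem laaksoGraph_connected : ∀ n, (laaksoGraph n).toSimpleGraph.Connected
  | 0 => EdgeGraph.singleEdge_connected
  | n + 1 => EdgeGraph.replaceEdges_connected _ _ (laaksoGraph_connected n)
      laaksoGadget_connected

/-! ### Shortest path metrics -/

/-- The shortest path metric of a connected graph all of whose edges have length `l`. -/
noncomputable abbrev shortestPathMetric {V : Type} (G : SimpleGraph V) (hG : G.Connected)
    (l : ℝ) (hl : 0 < l) : MetricSpace V where
  dist u v := l * (G.dist u v : ℝ)
  dist_self u := by simp
  dist_comm u v := by rw [SimpleGraph.dist_comm]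
  dist_triangle u v w := by
    rw [← mul_add]
    refine mul_le_mul_of_nonneg_left ?_ hl.le
    exact_mod_cast hG.dist_triangle
  eq_of_dist_eq_zero := by
    intro u v h
    have h0 : (G.dist u v : ℝ) = 0 := (mul_eq_zero.1 h).resolve_left hl.ne'
    exact hG.dist_eq_zero_iff.1 (by exact_mod_cast h0)

/-- The two normalizations in use. -/
inductive Normalization : Type
  | unweighted : Normalization
  | weighted : Normalization

/-- The length of an edge in the graph of level `n`: `1` in the unweighted case, `b⁻ⁿ` in the
weighted case. -/
noncomputable def edgeLength (b : ℝ) (n : ℕ) : Normalization → ℝ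
  | .unweighted => 1
  | .weighted => (b ^ n)⁻¹

theorem edgeLength_pos {b : ℝ} (hb : 0 < b) (n : ℕ) (ν : Normalization) :
    0 < edgeLength b n ν := by
  cases ν
  · exact one_pos
  · exact inv_pos.2 (pow_pos hb n)

/-- The vertex set of the diamond graph of level `n`, as a metric space. -/
def Diamond (_ν : Normalization) (n : ℕ) : Type := (diamondGraph n).V

/-- The vertex set of the Laakso graph of level `n`, as a metric space. -/
def Laakso (_ν : Normalization) (n : ℕ) : Type := (laaksoGraph n).V

/-- Diamond graphs carry the shortest path metric, with edges of length `1` or `2⁻ⁿ`. -/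
noncomputable instance Diamond.instMetricSpace (ν : Normalization) (n : ℕ) :
    MetricSpace (Diamond ν n) :=
  shortestPathMetric (diamondGraph n).toSimpleGraph (diamondGraph_connected n)
    (edgeLength 2 n ν) (edgeLength_pos two_pos n ν)

/-- Laakso graphs carry the shortest path metric, with edges of length `1` or `4⁻ⁿ`. -/
noncomputable instance Laakso.instMetricSpace (ν : Normalization) (n : ℕ) :
    MetricSpace (Laakso ν n) :=
  shortestPathMetric (laaksoGraph n).toSimpleGraph (laaksoGraph_connected n)
    (edgeLength 4 n ν) (edgeLength_pos four_pos n ν)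

/-! ### Bilipschitz embeddings -/

/-- `f` is a `C`-bilipschitz embedding, `1 ≤ C < ∞`. -/
def IsBilipschitzWith {A Y : Type*} [MetricSpace A] [MetricSpace Y] (C : ℝ) (f : A → Y) : Prop :=
  1 ≤ C ∧ ∃ r : ℝ, 0 < r ∧ ∀ u v : A,
    r * dist u v ≤ dist (f u) (f v) ∧ dist (f u) (f v) ≤ r * C * dist u v

/-- `f` is a bilipschitz embedding. -/
def IsBilipschitz {A Y : Type*} [MetricSpace A] [MetricSpace Y] (f : A → Y) : Prop :=
  ∃ C : ℝ, IsBilipschitzWith C f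

/-- The distortion of a bilipschitz embedding: the smallest `C` for which it is
`C`-bilipschitz. -/
noncomputable def distortion {A Y : Type*} [MetricSpace A] [MetricSpace Y] (f : A → Y) : ℝ :=
  sInf {C : ℝ | IsBilipschitzWith C f}

/-- The sequence `M` of metric spaces admits uniformly bilipschitz embeddings into the
sequence `R`. -/
def AdmitsUniformlyBilipschitzEmbeddings (M R : ℕ → Type*) [∀ n, MetricSpace (M n)]
    [∀ n, MetricSpace (R n)] : Prop :=
  ∃ (m : ℕ → ℕ) (f : ∀ n, M n → R (m n)),
    (∀ n, IsBilipschitz (f n)) ∧ ∃ B : ℝ, ∀ n, distortion (f n) ≤ B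

/-! Suppose that all Laakso graphs embed into diamond graphs with one constant `C`. Divide a cell
into subcells `N = 4 ^ (n + 2)` times shorter, and let `D` be the distance between the images of its
ends. If the images of the ends of some subcell are more than `D / (N - 1)` apart, the subcell is
stretched more than the cell by a factor of at least `N / (N - 1)`. Stretches are bounded, so this
cannot be repeated forever (`false_of_stretched`): some cell is mapped almost geodesically.

On such a cell, the first edge and the two branches behind it become a fork (`IsFork`,
`isFork_arms`): an almost geodesic stem from `u` to `p`, continued to `q` by two chains that are
close to each other only near `p` and `q`. Diamond graphs restrict forks. A part with two boundary
points `x` and `y`, filled by geodesics between them, can be left only through `x` or `y`. If both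
chains leave through the same point, separation puts `p` or `q` near it; if they leave through
different ones, both prolong the stem almost geodesically, and this forces `p` to be near one of
them (`IsFork.exists_near`). Applied to a cell and then to the two cells at a midpoint, this puts
`p` near a vertex of a level whose cells are not much shorter than the length bound `θ` of the fork
(`exists_near_old`).

Vertices of that level are far apart, so two forks cannot start at a moderate distance from each
other (`not_isFork_and_isFork`). An almost geodesic Laakso cell contains two such forks: one starts
at its vertex `p`, the other points backwards inside its edge `up` (`false_of_nearly_geodesic`). -/

/-- A symmetric function that vanishes on the diagonal and satisfies the triangle inequality. -/
structure IsPseudoDist {X : Type*} (δ : X → X → ℝ) : Prop where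
  self : ∀ x, δ x x = 0
  comm : ∀ x y, δ x y = δ y x
  triangle : ∀ x y z, δ x z ≤ δ x y + δ y z

theorem IsPseudoDist.comap {X Y : Type*} {δ : X → X → ℝ} (h : IsPseudoDist δ) (φ : Y → X) :
    IsPseudoDist (fun x y => δ (φ x) (φ y)) :=
  ⟨fun _ => h.self _, fun _ _ => h.comm _ _, fun _ _ _ => h.triangle _ _ _⟩

theorem IsPseudoDist.nonneg {X : Type*} {δ : X → X → ℝ} (h : IsPseudoDist δ) (x y : X) :
    0 ≤ δ x y := by
  have h1 := h.triangle x y x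
  rw [h.self, h.comm y x] at h1
  linarith

theorem IsPseudoDist.triangle_left {X : Type*} {δ : X → X → ℝ} (h : IsPseudoDist δ) (x y z : X) :
    δ x z ≤ δ y x + δ y z :=
  h.comm y x ▸ h.triangle x y z

theorem IsPseudoDist.triangle_right {X : Type*} {δ : X → X → ℝ} (h : IsPseudoDist δ) (x y z : X) :
    δ x z ≤ δ x y + δ z y :=
  h.comm z y ▸ h.triangle x y z

theorem isPseudoDist_real : IsPseudoDist (fun x y : ℝ => |x - y|) :=
  ⟨fun x => by simp, fun x y => abs_sub_comm x y, fun x y z => abs_sub_le x y z⟩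

/-! ### Graph distances, Lipschitz maps and exits of geodesics. -/

namespace EdgeGraph

/-- The graph distance as a real number. -/
noncomputable def gd (G : EdgeGraph) (u v : G.V) : ℝ := (G.toSimpleGraph.dist u v : ℝ)

/-- `z` is one of the two ends of `e`. -/
def IsEnd (G : EdgeGraph) (e : G.E) (z : G.V) : Prop := z = G.src e ∨ z = G.tgt e

/-- Connected and without loops. -/
structure Good (G : EdgeGraph) : Prop where
  connected : G.toSimpleGraph.Connected
  ne : ∀ e, G.src e ≠ G.tgt e

variable {G : EdgeGraph}

theorem Good.isPseudoDist (hG : G.Good) : IsPseudoDist G.gd where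
  self x := by simp [gd]
  comm x y := by simp only [gd, SimpleGraph.dist_comm]
  triangle x y z := by
    unfold gd
    exact_mod_cast hG.connected.dist_triangle

theorem Good.one_le_gd (hG : G.Good) {u v : G.V} (h : u ≠ v) : 1 ≤ G.gd u v := by
  unfold gd
  exact_mod_cast hG.connected.pos_dist_of_ne h

theorem Good.gd_ends (hG : G.Good) (e : G.E) : G.gd (G.src e) (G.tgt e) = 1 := by
  unfold gd
  have : G.toSimpleGraph.dist (G.src e) (G.tgt e) = 1 :=
    SimpleGraph.dist_eq_one_iff_adj.2
      ((SimpleGraph.fromRel_adj _ _ _).2 ⟨hG.ne e, Or.inl ⟨e, rfl, rfl⟩⟩)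
  exact_mod_cast this

theorem exists_edge_of_adj {u v : G.V} (h : G.toSimpleGraph.Adj u v) :
    ∃ e, (G.src e = u ∧ G.tgt e = v) ∨ (G.src e = v ∧ G.tgt e = u) := by
  rcases ((SimpleGraph.fromRel_adj _ _ _).1 h).2 with ⟨e, h⟩ | ⟨e, h⟩
  · exact ⟨e, Or.inl h⟩
  · exact ⟨e, Or.inr h⟩

/-- A map that stretches every edge by at most `c` is `c`-Lipschitz. -/
theorem Good.lipschitz (hG : G.Good) {X : Type*} {δ : X → X → ℝ} (hδ : IsPseudoDist δ)
    (φ : G.V → X) {c : ℝ} (h : ∀ e, δ (φ (G.src e)) (φ (G.tgt e)) ≤ c) (u v : G.V) :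
    δ (φ u) (φ v) ≤ c * G.gd u v := by
  obtain ⟨p, hp⟩ := hG.connected.exists_walk_length_eq_dist u v
  unfold gd
  rw [← hp]
  clear hp
  induction p with
  | nil => simp [hδ.self]
  | @cons u w v hadj p ih =>
    have h1 : δ (φ u) (φ w) ≤ c := by
      obtain ⟨e, ⟨rfl, rfl⟩ | ⟨rfl, rfl⟩⟩ := exists_edge_of_adj hadj
      · exact h e
      · rw [hδ.comm]
        exact h e
    have h2 := hδ.triangle (φ u) (φ w) (φ v)
    rw [SimpleGraph.Walk.length_cons]
    push_cast
    linarith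

/-- A geodesic that leaves a set does so along an edge. -/
theorem Good.exists_exit (hG : G.Good) (T : Set G.V) {z z' : G.V} (hz : z ∈ T) (hz' : z' ∉ T) :
    ∃ a ∈ T, ∃ b, b ∉ T ∧ G.toSimpleGraph.Adj a b ∧ G.gd z z' = G.gd z a + G.gd a z' := by
  obtain ⟨p, hp⟩ := hG.connected.exists_walk_length_eq_dist z z'
  -- The inequality holds for every walk, geodesic or not, and so can be proved by induction on the
  -- walk.
  suffices H : ∃ a ∈ T, ∃ b, b ∉ T ∧ G.toSimpleGraph.Adj a b ∧
      G.gd z a + G.gd a z' ≤ p.length by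
    obtain ⟨a, ha, b, hb, hab, h⟩ := H
    refine ⟨a, ha, b, hb, hab, le_antisymm (hG.isPseudoDist.triangle _ _ _) ?_⟩
    rw [hp] at h
    exact h
  clear hp
  induction p with
  | nil => exact absurd hz hz'
  | @cons u w v hadj p ih =>
    rw [SimpleGraph.Walk.length_cons]
    push_cast
    by_cases hw : w ∈ T
    · obtain ⟨a, ha, b, hb, hab, h⟩ := ih hw hz'
      refine ⟨a, ha, b, hb, hab, ?_⟩
      have h1 := hG.isPseudoDist.triangle u w a
      have h2 : G.gd u w = 1 := by
        unfold gd
        exact_mod_cast SimpleGraph.dist_eq_one_iff_adj.2 hadj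
      linarith
    · refine ⟨u, hz, w, hw, hadj, ?_⟩
      have h1 : G.gd u v ≤ ((SimpleGraph.Walk.cons hadj p).length : ℝ) := by
        unfold gd
        exact_mod_cast SimpleGraph.dist_le _
      rw [SimpleGraph.Walk.length_cons] at h1
      push_cast at h1
      rw [hG.isPseudoDist.self]
      linarith

theorem singleEdge_good : singleEdge.Good :=
  ⟨singleEdge_connected, fun _ => Bool.false_ne_true⟩

end EdgeGraph

/-! ### Graded gadgets. -/

/-- A gadget whose edges all point upwards with respect to a height function `ht`, in which every
vertex lies on an ascending path of length `b` between the distinguished vertices. -/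
structure Gadget.Graded (K : Gadget) (b : ℕ) where
  /-- The height of a vertex above the first distinguished vertex. -/
  ht : GadgetVertex K.W → ℕ
  ht_first : ht .first = 0
  ht_second : ht .second = b
  ht_tgt : ∀ f, ht (K.tgt f) = ht (K.src f) + 1
  connected : K.toEdgeGraph.toSimpleGraph.Connected
  -- The pseudo-distance is arbitrary so that this serves both for the graph metric and for the
  -- target metric pulled back by an embedding.
  path_le : ∀ {δ : GadgetVertex K.W → GadgetVertex K.W → ℝ} (_ : IsPseudoDist δ) {c : ℝ}
    (_ : ∀ f, δ (K.src f) (K.tgt f) ≤ c) (x : GadgetVertex K.W),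
    δ .first x ≤ c * ht x ∧ δ x .second ≤ c * (b - ht x)
  cross : ∀ T : Set (GadgetVertex K.W), .first ∈ T → .second ∉ T →
    ∃ f, K.src f ∈ T ∧ K.tgt f ∉ T

/-- The quadrilateral is graded of length two. -/
def diamondGraded : diamondGadget.Graded 2 where
  ht x := match x with
    | .first => 0
    | .second => 2
    | .inner _ => 1
  ht_first := rfl
  ht_second := rfl
  ht_tgt f := by cases f <;> rfl
  connected := diamondGadget_connected
  path_le := by
    intro δ hδ c h x
    have h1 : δ .first (.inner .a) ≤ c := h .ua
    have h2 : δ (.inner .a) .second ≤ c := h .av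
    have h3 : δ .first (.inner .b) ≤ c := h .ub
    have h4 : δ (.inner .b) .second ≤ c := h .bv
    have t := hδ.triangle .first (.inner .a) .second
    rcases x with _ | _ | (_ | _) <;> norm_num [hδ.self] <;> first
      | linarith
      | exact ⟨by linarith, by linarith⟩
  cross := by
    intro T h1 h2
    by_cases h : (.inner .a : GadgetVertex DiamondInner) ∈ T
    · exact ⟨.av, h, h2⟩
    · exact ⟨.ua, h1, h⟩

/-- The Laakso graph of level one is graded of length four. -/
def laaksoGraded : laaksoGadget.Graded 4 where
  ht x := match x with
    | .first => 0
    | .second => 4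
    | .inner .p => 1
    | .inner .c => 2
    | .inner .d => 2
    | .inner .q => 3
  ht_first := rfl
  ht_second := rfl
  ht_tgt f := by cases f <;> rfl
  connected := laaksoGadget_connected
  path_le := by
    intro δ hδ c h x
    have h1 : δ .first (.inner .p) ≤ c := h .up
    have h2 : δ (.inner .p) (.inner .c) ≤ c := h .pc
    have h3 : δ (.inner .p) (.inner .d) ≤ c := h .pd
    have h4 : δ (.inner .c) (.inner .q) ≤ c := h .cq
    have h5 : δ (.inner .d) (.inner .q) ≤ c := h .dq
    have h6 : δ (.inner .q) .second ≤ c := h .qv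
    have t1 := hδ.triangle .first (.inner .p) (.inner .c)
    have t2 := hδ.triangle .first (.inner .p) (.inner .d)
    have t3 := hδ.triangle .first (.inner .c) (.inner .q)
    have t4 := hδ.triangle .first (.inner .q) .second
    have t5 := hδ.triangle (.inner .c) (.inner .q) .second
    have t6 := hδ.triangle (.inner .d) (.inner .q) .second
    have t7 := hδ.triangle (.inner .p) (.inner .c) .second
    rcases x with _ | _ | (_ | _ | _ | _) <;> norm_num [hδ.self] <;> first
      | linarith
      | exact ⟨by linarith, by linarith⟩
  cross := by
    intro T h1 h2
    by_cases h3 : (.inner .p : GadgetVertex LaaksoInner) ∈ T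
    · by_cases h4 : (.inner .c : GadgetVertex LaaksoInner) ∈ T
      · by_cases h5 : (.inner .q : GadgetVertex LaaksoInner) ∈ T
        · exact ⟨.qv, h5, h2⟩
        · exact ⟨.cq, h4, h5⟩
      · exact ⟨.pc, h3, h4⟩
    · exact ⟨.up, h1, h3⟩

/-! ### Distances after one replacement of edges. -/

namespace EdgeGraph

/-- Interpolation along edges of a real function on the vertices. -/
noncomputable def interpolate (G : EdgeGraph) {K : Gadget} {b : ℕ} (hK : K.Graded b)
    (φ : G.V → ℝ) : (G.replaceEdges K).V → ℝ
  | .inl v => b * φ v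
  | .inr (e, w) => b * φ (G.src e) + hK.ht (.inner w) * (φ (G.tgt e) - φ (G.src e))

theorem interpolate_place (G : EdgeGraph) {K : Gadget} {b : ℕ} (hK : K.Graded b)
    (φ : G.V → ℝ) (e : G.E) (x : GadgetVertex K.W) :
    G.interpolate hK φ (G.place K.W e x) =
      b * φ (G.src e) + hK.ht x * (φ (G.tgt e) - φ (G.src e)) := by
  rcases x with _ | _ | w
  · simp [place, interpolate, hK.ht_first]
  · simp [place, interpolate, hK.ht_second]
    ring
  · rfl

theorem place_injective {G : EdgeGraph} (hG : G.Good) (W : Type) (e : G.E) :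
    Function.Injective (G.place W e) := by
  have h := hG.ne e
  have h' := h.symm
  intro x y hxy
  cases x <;> cases y <;> simp_all [place]

theorem Good.replaceEdges {G : EdgeGraph} (hG : G.Good) {K : Gadget} {b : ℕ}
    (hK : K.Graded b) : (G.replaceEdges K).Good where
  connected := replaceEdges_connected G K hG.connected hK.connected
  ne := by
    rintro ⟨e, f⟩ h
    have h1 := congrArg hK.ht (place_injective hG K.W e h)
    rw [hK.ht_tgt] at h1
    omega

/-- For the upper bound, each old edge becomes a path of length `b`. For the lower bound, the
distance from `u`, multiplied by `b` and interpolated by height along the new edges, is 1-Lipschitz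
on the new graph. -/
theorem gd_replaceEdges {G : EdgeGraph} (hG : G.Good) {K : Gadget} {b : ℕ}
    (hK : K.Graded b) (u v : G.V) :
    (G.replaceEdges K).gd (Sum.inl u) (Sum.inl v) = b * G.gd u v := by
  have hG' := hG.replaceEdges hK
  refine le_antisymm ?_ ?_
  · refine hG.lipschitz hG'.isPseudoDist Sum.inl (fun e => ?_) u v
    have h := (hK.path_le (hG'.isPseudoDist.comap (G.place K.W e)) (c := 1)
      (fun f => (hG'.gd_ends (e, f)).le) .second).1
    rw [hK.ht_second, one_mul] at h
    exact h
  · have h := hG'.lipschitz isPseudoDist_real (G.interpolate hK (fun v => G.gd u v)) (c := 1)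
      (fun p => ?_) (Sum.inl u) (Sum.inl v)
    · simp only [interpolate, hG.isPseudoDist.self, one_mul] at h
      rw [abs_sub_comm] at h
      exact (le_of_eq (by ring)).trans ((le_abs_self _).trans h)
    · obtain ⟨e, f⟩ := p
      change |G.interpolate hK _ (G.place K.W e (K.src f)) -
        G.interpolate hK _ (G.place K.W e (K.tgt f))| ≤ 1
      rw [interpolate_place, interpolate_place, hK.ht_tgt, Nat.cast_add, Nat.cast_one]
      have h1 := hG.isPseudoDist.triangle u (G.src e) (G.tgt e)
      have h2 := hG.isPseudoDist.triangle u (G.tgt e) (G.src e)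
      have h3 := hG.isPseudoDist.comm (G.tgt e) (G.src e)
      have h4 := hG.gd_ends e
      rw [abs_le]
      constructor <;> linarith

/-! ### Iterated edge replacement -/

/-- The graph obtained from `G` by replacing edges `n` times. -/
def iter (K : Gadget) : EdgeGraph → ℕ → EdgeGraph
  | G, 0 => G
  | G, n + 1 => iter K (G.replaceEdges K) n

/-- The vertices of `G` as vertices of the iterated replacement. -/
def lift (K : Gadget) : (G : EdgeGraph) → (n : ℕ) → G.V → (iter K G n).V
  | _, 0 => id
  | G, n + 1 => fun v => lift K (G.replaceEdges K) n (Sum.inl v)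

/-- The edge of `G` from which an edge of the iterated replacement descends. -/
def anc (K : Gadget) : (G : EdgeGraph) → (n : ℕ) → (iter K G n).E → G.E
  | _, 0 => id
  | G, n + 1 => fun f => (anc K (G.replaceEdges K) n f).1

variable {K : Gadget} {b : ℕ} {G : EdgeGraph}

theorem Good.iter (hG : G.Good) (hK : K.Graded b) (n : ℕ) : (iter K G n).Good := by
  induction n generalizing G with
  | zero => exact hG
  | succ n ih => exact ih (hG.replaceEdges hK)

theorem gd_lift (hG : G.Good) (hK : K.Graded b) (n : ℕ) (u v : G.V) :
    (iter K G n).gd (lift K G n u) (lift K G n v) = (b : ℝ) ^ n * G.gd u v := by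
  induction n generalizing G with
  | zero => simp [iter, lift]
  | succ n ih =>
    have h := ih (hG.replaceEdges hK) (Sum.inl u) (Sum.inl v)
    rw [gd_replaceEdges hG hK] at h
    rw [pow_succ, mul_assoc]
    exact h

/-- Diamond and Laakso graphs are defined by a last replacement, `iter` by a first one; this
reconciles the two. -/
theorem iter_replaceEdges (K : Gadget) (G : EdgeGraph) (n : ℕ) :
    iter K (G.replaceEdges K) n = (iter K G n).replaceEdges K := by
  induction n generalizing G with
  | zero => rfl
  | succ n ih => exact ih _

theorem iter_add (K : Gadget) (G : EdgeGraph) (m n : ℕ) :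
    iter K (iter K G m) n = iter K G (m + n) := by
  induction m generalizing G with
  | zero => simp [iter]
  | succ m ih =>
    rw [Nat.succ_add]
    exact ih _

/-- The pseudo-distances along a gadget whose edges are iteratively replaced. -/
theorem path_le_lift_place (hK : K.Graded b) (n : ℕ) (e : G.E)
    {δ : (iter K G (n + 1)).V → (iter K G (n + 1)).V → ℝ} (hδ : IsPseudoDist δ) {c : ℝ}
    (h : ∀ f, δ (lift K (G.replaceEdges K) n (G.place K.W e (K.src f)))
      (lift K (G.replaceEdges K) n (G.place K.W e (K.tgt f))) ≤ c) (x : GadgetVertex K.W) :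
    δ (lift K G (n + 1) (G.src e)) (lift K (G.replaceEdges K) n (G.place K.W e x)) ≤
        c * hK.ht x ∧
      δ (lift K (G.replaceEdges K) n (G.place K.W e x)) (lift K G (n + 1) (G.tgt e)) ≤
        c * (b - hK.ht x) :=
  hK.path_le (hδ.comap fun x => lift K (G.replaceEdges K) n (G.place K.W e x)) h x

/-- The ends of a cell are joined by a path of `b ^ n` edges inside the cell; the bound `c` is
needed only on edges of that cell. -/
theorem lift_ends_le (hK : K.Graded b) (n : ℕ) (e : G.E)
    {δ : (iter K G n).V → (iter K G n).V → ℝ} (hδ : IsPseudoDist δ) {c : ℝ}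
    (h : ∀ f, anc K G n f = e → δ ((iter K G n).src f) ((iter K G n).tgt f) ≤ c) :
    δ (lift K G n (G.src e)) (lift K G n (G.tgt e)) ≤ c * (b : ℝ) ^ n := by
  induction n generalizing G with
  | zero =>
    rw [pow_zero, mul_one]
    exact h e rfl
  | succ n ih =>
    have h1 := (path_le_lift_place hK n e hδ (c := c * (b : ℝ) ^ n) (fun f =>
      ih (G := G.replaceEdges K) (e, f) hδ fun f' hf' => h f' (congrArg Prod.fst hf'))
      .second).1
    rw [hK.ht_second, mul_assoc, ← pow_succ] at h1
    exact h1

/-- The pseudo-distances within the cell of an edge of `G`, in terms of the heights. -/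
theorem exists_height (hK : K.Graded b) (n : ℕ) (f : (iter K G n).E) :
    ∃ h : ℕ, ∀ {δ : (iter K G n).V → (iter K G n).V → ℝ}
      (_ : IsPseudoDist δ) {c : ℝ} (_ : ∀ f', anc K G n f' = anc K G n f →
        δ ((iter K G n).src f') ((iter K G n).tgt f') ≤ c),
      δ (lift K G n (G.src (anc K G n f))) ((iter K G n).src f) ≤ c * h ∧
      δ (lift K G n (G.src (anc K G n f))) ((iter K G n).tgt f) ≤ c * (h + 1) ∧
      δ ((iter K G n).src f) (lift K G n (G.tgt (anc K G n f))) ≤ c * ((b : ℝ) ^ n - h) ∧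
      δ ((iter K G n).tgt f) (lift K G n (G.tgt (anc K G n f))) ≤
        c * ((b : ℝ) ^ n - (h + 1)) := by
  induction n generalizing G with
  | zero =>
    refine ⟨0, fun {δ} hδ {c} h => ?_⟩
    have h1 : δ (G.src f) (G.tgt f) ≤ c := h f rfl
    have h2 : δ (G.src f) (G.src f) ≤ c * (0 : ℕ) := ((hδ.self _).trans (by simp)).le
    have h3 : δ (G.tgt f) (G.tgt f) ≤ c * ((b : ℝ) ^ 0 - ((0 : ℕ) + 1)) :=
      ((hδ.self _).trans (by simp)).le
    exact ⟨h2, h1.trans (by simp), h1.trans (by simp), h3⟩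
  | succ n ih =>
    obtain ⟨h', H⟩ := ih (G := G.replaceEdges K) f
    rcases hef : anc K (G.replaceEdges K) n f with ⟨e, φ⟩
    have hanc : anc K G (n + 1) f = e := congrArg Prod.fst hef
    -- The edge `f` sits at height `h'` in its subcell, and the subcell starts at height `ht (K.src
    -- φ)` in units of `b ^ n`.
    refine ⟨b ^ n * hK.ht (K.src φ) + h', fun {δ} hδ {c} hc => ?_⟩
    rw [hanc] at hc ⊢
    have P := path_le_lift_place hK n e hδ (c := c * (b : ℝ) ^ n) (fun ψ =>
      lift_ends_le (G := G.replaceEdges K) hK n (e, ψ) hδ fun f' hf' =>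
        hc f' (congrArg Prod.fst hf'))
    have P1 := (P (K.src φ)).1
    have P2 := (P (K.tgt φ)).2
    rw [hK.ht_tgt] at P2
    obtain ⟨H1, H2, H3, H4⟩ := H hδ (c := c) (fun f' hf' =>
      hc f' ((congrArg Prod.fst hf').trans (congrArg Prod.fst hef)))
    rw [hef] at H1 H2 H3 H4
    have T1 := hδ.triangle _ _ ((iter K G (n + 1)).src f) |>.trans (add_le_add P1 H1)
    have T2 := hδ.triangle _ _ ((iter K G (n + 1)).tgt f) |>.trans (add_le_add P1 H2)
    have T3 := hδ.triangle ((iter K G (n + 1)).src f) _ _ |>.trans (add_le_add H3 P2)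
    have T4 := hδ.triangle ((iter K G (n + 1)).tgt f) _ _ |>.trans (add_le_add H4 P2)
    push_cast at T1 T2 T3 T4 ⊢
    exact ⟨T1.trans (le_of_eq (by ring)), T2.trans (le_of_eq (by ring)),
      T3.trans (le_of_eq (by ring)), T4.trans (le_of_eq (by ring))⟩

/-- The vertices of a cell, up to pseudo-distances that are bounded by `c` on its edges, lie on a
path of length `c * b ^ n` between the ends of the cell. -/
theorem exists_split (hK : K.Graded b) (n : ℕ) {f : (iter K G n).E} {e : G.E}
    (hf : anc K G n f = e) {z : (iter K G n).V} (hz : (iter K G n).IsEnd f z)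
    {δ : (iter K G n).V → (iter K G n).V → ℝ} (hδ : IsPseudoDist δ) {c : ℝ}
    (hc : ∀ f', anc K G n f' = e → δ ((iter K G n).src f') ((iter K G n).tgt f') ≤ c) :
    ∃ s : ℝ, δ (lift K G n (G.src e)) z ≤ s ∧
      δ z (lift K G n (G.tgt e)) ≤ c * (b : ℝ) ^ n - s := by
  subst hf
  obtain ⟨h, H⟩ := exists_height hK n f
  obtain ⟨H1, H2, H3, H4⟩ := H hδ hc
  rcases hz with rfl | rfl
  · exact ⟨c * h, H1, H3.trans (le_of_eq (by ring))⟩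
  · exact ⟨c * (h + 1), H2, H4.trans (le_of_eq (by ring))⟩

theorem gd_lift_ends (hG : G.Good) (hK : K.Graded b) (n : ℕ) (e : G.E) :
    (iter K G n).gd (lift K G n (G.src e)) (lift K G n (G.tgt e)) = (b : ℝ) ^ n := by
  rw [gd_lift hG hK, hG.gd_ends, mul_one]

/-- A vertex of a cell lies on a geodesic between the ends of the cell. -/
theorem gd_add_gd_of_isEnd (hG : G.Good) (hK : K.Graded b) (n : ℕ) {f : (iter K G n).E} {e : G.E}
    (hf : anc K G n f = e) {z : (iter K G n).V} (hz : (iter K G n).IsEnd f z) :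
    (iter K G n).gd z (lift K G n (G.src e)) + (iter K G n).gd z (lift K G n (G.tgt e)) =
      (b : ℝ) ^ n := by
  have hH := hG.iter hK n
  obtain ⟨s, h1, h2⟩ := exists_split hK n hf hz hH.isPseudoDist (c := 1)
    fun f' _ => (hH.gd_ends f').le
  have h3 := hH.isPseudoDist.triangle (lift K G n (G.src e)) z (lift K G n (G.tgt e))
  rw [gd_lift_ends hG hK] at h3
  rw [hH.isPseudoDist.comm z (lift K G n (G.src e))]
  linarith

/-- Different cells meet only in common ends. -/
theorem exists_lift_of_isEnd_of_isEnd (n : ℕ) {f f' : (iter K G n).E} {z : (iter K G n).V}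
    (h : (iter K G n).IsEnd f z) (h' : (iter K G n).IsEnd f' z)
    (hne : anc K G n f ≠ anc K G n f') :
    ∃ w, z = lift K G n w ∧ G.IsEnd (anc K G n f) w ∧ G.IsEnd (anc K G n f') w := by
  induction n generalizing G with
  | zero => exact ⟨z, rfl, h, h'⟩
  | succ n ih =>
    obtain ⟨w, hz, hw, hw'⟩ := ih (G := G.replaceEdges K) h h' fun hh =>
      hne (congrArg Prod.fst hh)
    have hne' : (anc K (G.replaceEdges K) n f).1 ≠ (anc K (G.replaceEdges K) n f').1 := hne
    change ∃ w, z = lift K G (n + 1) w ∧ G.IsEnd (anc K (G.replaceEdges K) n f).1 w ∧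
      G.IsEnd (anc K (G.replaceEdges K) n f').1 w
    generalize anc K (G.replaceEdges K) n f = p at *
    generalize anc K (G.replaceEdges K) n f' = p' at *
    obtain ⟨e, φ⟩ := p
    obtain ⟨e', φ'⟩ := p'
    have key : ∀ e φ, (G.replaceEdges K).IsEnd (e, φ) w → ∃ x, w = G.place K.W e x :=
      fun e φ hw => hw.elim (fun h => ⟨_, h⟩) (fun h => ⟨_, h⟩)
    have key2 : ∀ (v : G.V) e x, Sum.inl v = G.place K.W e x → G.IsEnd e v := by
      rintro v e (_ | _ | x) hx
      · exact Or.inl (Sum.inl.inj hx)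
      · exact Or.inr (Sum.inl.inj hx)
      · cases hx
    obtain ⟨x, hx⟩ := key _ _ hw
    obtain ⟨x', hx'⟩ := key _ _ hw'
    -- A common end in the finer graph is either an old vertex or a new one, and a new vertex
    -- belongs to the copy over a single edge.
    rcases w with v | ⟨e₀, w₀⟩
    · exact ⟨v, hz, key2 _ _ _ hx, key2 _ _ _ hx'⟩
    · have aux : ∀ e x, Sum.inr (e₀, w₀) = G.place K.W e x → e = e₀ := by
        rintro e (_ | _ | x) hx
        · cases hx
        · cases hx
        · exact (Prod.ext_iff.1 (Sum.inr.inj hx)).1.symm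
      exact absurd ((aux _ _ hx).trans (aux _ _ hx').symm) hne'

/-- A set that contains exactly one end of a cell is left along an edge of the cell. -/
theorem exists_crossing_edge (hK : K.Graded b) (n : ℕ) (e : G.E) (T : Set (iter K G n).V)
    (h1 : lift K G n (G.src e) ∈ T) (h2 : lift K G n (G.tgt e) ∉ T) :
    ∃ f, anc K G n f = e ∧ (iter K G n).src f ∈ T ∧ (iter K G n).tgt f ∉ T := by
  induction n generalizing G with
  | zero => exact ⟨e, rfl, h1, h2⟩
  | succ n ih =>
    obtain ⟨φ, hφ1, hφ2⟩ := hK.cross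
      {x | lift K (G.replaceEdges K) n (G.place K.W e x) ∈ T} h1 h2
    obtain ⟨f, hf, hf1, hf2⟩ := ih (G := G.replaceEdges K) (e, φ) T hφ1 hφ2
    exact ⟨f, congrArg Prod.fst hf, hf1, hf2⟩

/-! ### Regions and their boundaries. -/

/-- The vertices of the cells of the edges in `𝒜`. -/
def region (K : Gadget) (G : EdgeGraph) (n : ℕ) (𝒜 : Set G.E) : Set (iter K G n).V :=
  {z | ∃ f, anc K G n f ∈ 𝒜 ∧ (iter K G n).IsEnd f z}

/-- The edges in `𝒜` and the other edges have no common ends except `x` and `y`. -/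
def IsBoundary (G : EdgeGraph) (𝒜 : Set G.E) (x y : G.V) : Prop :=
  ∀ e ∈ 𝒜, ∀ e' ∉ 𝒜, ∀ w, G.IsEnd e w → G.IsEnd e' w → w = x ∨ w = y

theorem IsBoundary.eq_of_mem {𝒜 : Set G.E} {x y : G.V} (h : G.IsBoundary 𝒜 x y) (n : ℕ)
    {z : (iter K G n).V} (hz : z ∈ region K G n 𝒜) (hz' : z ∈ region K G n 𝒜ᶜ) :
    z = lift K G n x ∨ z = lift K G n y := by
  obtain ⟨f, hf, hfz⟩ := hz
  obtain ⟨f', hf', hfz'⟩ := hz'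
  obtain ⟨w, rfl, hw, hw'⟩ := exists_lift_of_isEnd_of_isEnd n hfz hfz'
    (fun hh => hf' (hh ▸ hf))
  rcases h _ hf _ hf' w hw hw' with rfl | rfl
  · exact Or.inl rfl
  · exact Or.inr rfl

/-- A geodesic that leaves a region passes through its boundary. -/
theorem IsBoundary.gd_eq {𝒜 : Set G.E} {x y : G.V} (h : G.IsBoundary 𝒜 x y) {n : ℕ}
    (hH : (iter K G n).Good) {z z' : (iter K G n).V} (hz : z ∈ region K G n 𝒜)
    (hz' : z' ∉ region K G n 𝒜) :
    (iter K G n).gd z z' = (iter K G n).gd z (lift K G n x) + (iter K G n).gd (lift K G n x) z' ∨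
    (iter K G n).gd z z' =
      (iter K G n).gd z (lift K G n y) + (iter K G n).gd (lift K G n y) z' := by
  obtain ⟨a, ha, c, hc, hac, hd⟩ := hH.exists_exit _ hz hz'
  obtain ⟨f, hf⟩ := exists_edge_of_adj hac
  have hfa : (iter K G n).IsEnd f a := hf.elim (fun h => Or.inl h.1.symm) fun h => Or.inr h.2.symm
  have hfc : (iter K G n).IsEnd f c := hf.elim (fun h => Or.inr h.2.symm) fun h => Or.inl h.1.symm
  -- The exit edge descends from an edge outside `𝒜`, so its starting point `a` lies in both
  -- regions.
  rcases h.eq_of_mem n ha ⟨f, fun hh => hc ⟨f, hh, hfc⟩, hfa⟩ with rfl | rfl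
  · exact Or.inl hd
  · exact Or.inr hd

end EdgeGraph

/-! ### Forks in a metric space. -/

/-- Two chains with steps of length at most `σ` from `p` to `q`, contained in `A` and `B`
respectively, that extend a geodesic from `u` to `p` up to an error `σ` and are separated from
each other away from `p` and `q`. -/
structure IsFork {X : Type*} (δ : X → X → ℝ) (σ κ θ : ℝ) (u p q : X) (A B : Set X) : Prop where
  stem : 3 * σ < δ u p
  long : θ ≤ δ p q
  chain_left : ∀ T : Set X, p ∈ T → q ∉ T → ∃ z ∈ A, ∃ z', z' ∉ T ∧ z ∈ T ∧ δ z z' ≤ σ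
  chain_right : ∀ T : Set X, p ∈ T → q ∉ T → ∃ z ∈ B, ∃ z', z' ∉ T ∧ z ∈ T ∧ δ z z' ≤ σ
  geodesic_left : ∀ z ∈ A, δ u p + δ p z ≤ δ u z + σ
  geodesic_right : ∀ z ∈ B, δ u p + δ p z ≤ δ u z + σ
  separated : ∀ z ∈ A, ∀ w ∈ B, δ z w ≤ 2 * σ → δ p z ≤ κ ∨ δ q z ≤ κ

/-- If a fork leaves a set with two boundary points `x` and `y` all of whose points lie on
geodesics between `x` and `y`, then `p` or `q` is close to `x` or `y`. -/
theorem IsFork.exists_near {X : Type*} {δ : X → X → ℝ} (hδ : IsPseudoDist δ) {σ κ θ : ℝ}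
    (hσκ : σ ≤ κ) (hκ : 0 ≤ κ + σ) {u p q : X} {A B : Set X} (hF : IsFork δ σ κ θ u p q A B)
    {T : Set X} {x y : X} {l : ℝ}
    (hsum : ∀ t ∈ T, δ t x + δ t y = l)
    (hcut : ∀ t ∈ T, ∀ z ∉ T, δ t z = δ t x + δ x z ∨ δ t z = δ t y + δ y z)
    (hp : p ∈ T) (hq : q ∉ T) :
    (δ p x ≤ κ + σ ∨ δ q x ≤ κ + σ) ∨ (δ p y ≤ κ + σ ∨ δ q y ≤ κ + σ) := by
  obtain ⟨z, hzA, z', hz', hz, hzz⟩ := hF.chain_left T hp hq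
  obtain ⟨w, hwB, w', hw', hw, hww⟩ := hF.chain_right T hp hq
  have hgz := hF.geodesic_left z hzA
  have hgw := hF.geodesic_right w hwB
  have hstem := hF.stem
  -- Both chains leave near the same point `s`: then `z` and `w` are within `2 * σ`, and separation
  -- applies.
  have same : ∀ s, δ z s ≤ σ → δ w s ≤ σ → δ p s ≤ κ + σ ∨ δ q s ≤ κ + σ := by
    intro s h1 h2
    have h3 := hδ.triangle_right z s w
    rcases hF.separated z hzA w hwB (by linarith) with h | h
    · exact Or.inl ((hδ.triangle p z s).trans (add_le_add h h1))
    · exact Or.inr ((hδ.triangle q z s).trans (add_le_add h h1))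
  have far : ∀ s t, δ t s ≤ σ → δ u p + δ p t ≤ δ u t + σ → δ u p + δ p s ≤ δ u s + 3 * σ := by
    intro s t h1 h2
    have h3 := hδ.triangle p t s
    have h4 := hδ.triangle u s t
    rw [hδ.comm s t] at h4
    linarith
  -- The chains leave near different points. If `u ∈ T`, adding both near-geodesic inequalities
  -- bounds `2 * δ u p` by `6 * σ`, against the stem. Otherwise a geodesic from `p` to `u` passes
  -- through, say, `s`, although going from `u` via `p` to `s` is almost geodesic; hence `2 * δ p s
  -- ≤ 3 * σ`.
  have diff : ∀ s s', δ u p + δ p s ≤ δ u s + 3 * σ → δ u p + δ p s' ≤ δ u s' + 3 * σ →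
      (δ p s + δ p s' = l) → (∀ t ∈ T, δ t s + δ t s' = l) →
      (u ∉ T → δ p u = δ p s + δ s u ∨ δ p u = δ p s' + δ s' u) →
      δ p s ≤ κ + σ ∨ δ p s' ≤ κ + σ := by
    intro s s' h1 h2 h3 h4 h5
    by_cases hu : u ∈ T
    · have := h4 u hu
      linarith
    · rcases h5 hu with h | h
      · rw [hδ.comm p u, hδ.comm s u] at h
        left
        linarith
      · rw [hδ.comm p u, hδ.comm s' u] at h
        right
        linarith
  -- A step out of `T` passes metrically through `x` or `y`, so it starts within its own length of
  -- that point.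
  have near : ∀ t t', δ t t' ≤ σ → t ∈ T → t' ∉ T → δ t x ≤ σ ∨ δ t y ≤ σ := by
    intro t t' h ht ht'
    rcases hcut t ht t' ht' with h1 | h1
    · have := hδ.nonneg x t'
      left
      linarith
    · have := hδ.nonneg y t'
      right
      linarith
  rcases near z z' hzz hz hz' with h1 | h1 <;> rcases near w w' hww hw hw' with h2 | h2
  · exact Or.inl (same x h1 h2)
  · rcases diff x y (far x z h1 hgz) (far y w h2 hgw) (hsum p hp) hsum
      (fun hu => hcut p hp u hu) with h | h
    · exact Or.inl (Or.inl h)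
    · exact Or.inr (Or.inl h)
  · rcases diff x y (far x w h2 hgw) (far y z h1 hgz) (hsum p hp) hsum
      (fun hu => hcut p hp u hu) with h | h
    · exact Or.inl (Or.inl h)
    · exact Or.inr (Or.inl h)
  · exact Or.inr (same y h1 h2)

/-! ### Forks in diamond graphs. -/

namespace EdgeGraph

theorem Good.exists_isEnd {G : EdgeGraph} (hG : G.Good) {u v : G.V} (h : u ≠ v) :
    ∃ e, G.IsEnd e u := by
  obtain ⟨a, ha, b, -, hab, -⟩ := hG.exists_exit {u} (Set.mem_singleton u)
    (z' := v) (fun hh => h hh.symm)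
  obtain rfl : a = u := ha
  obtain ⟨e, he | he⟩ := exists_edge_of_adj hab
  · exact ⟨e, Or.inl he.1.symm⟩
  · exact ⟨e, Or.inr he.2.symm⟩

theorem isBoundary_singleton (G : EdgeGraph) (e : G.E) :
    G.IsBoundary {e} (G.src e) (G.tgt e) := by
  rintro _ rfl _ - w hw -
  exact hw

/-- A fork that is longer than a cell starts close to a vertex of the coarse graph. -/
theorem exists_near_lift {G : EdgeGraph} (hG : G.Good) {K : Gadget} {b : ℕ} (hK : K.Graded b)
    (n : ℕ) {σ κ θ : ℝ} (hσκ : σ ≤ κ) (hκ : 0 ≤ κ + σ) {u p q : (iter K G n).V}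
    {A B : Set (iter K G n).V} (hF : IsFork (iter K G n).gd σ κ θ u p q A B)
    (hn : (b : ℝ) ^ n < θ - (κ + σ)) :
    ∃ (f : (iter K G n).E) (a : G.V), (iter K G n).IsEnd f p ∧ G.IsEnd (anc K G n f) a ∧
      (iter K G n).gd p (lift K G n a) ≤ κ + σ := by
  have hH := hG.iter hK n
  have hδ := hH.isPseudoDist
  have hpq : p ≠ q := by
    rintro rfl
    have h1 := hF.long
    rw [hδ.self] at h1
    have : (0 : ℝ) ≤ (b : ℝ) ^ n := by positivity
    linarith
  obtain ⟨f, hf⟩ := hH.exists_isEnd hpq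
  have hsum : ∀ t ∈ region K G n {anc K G n f},
      (iter K G n).gd t (lift K G n (G.src (anc K G n f))) +
        (iter K G n).gd t (lift K G n (G.tgt (anc K G n f))) = (b : ℝ) ^ n := by
    rintro t ⟨f', hf', ht⟩
    exact gd_add_gd_of_isEnd hG hK n hf' ht
  have hp : p ∈ region K G n {anc K G n f} := ⟨f, rfl, hf⟩
  -- Two points of a cell are at most `b ^ n` apart, which is less than `θ`.
  have hq : q ∉ region K G n {anc K G n f} := by
    intro hq
    have h1 := hsum p hp
    have h2 := hsum q hq
    have h3 := hδ.triangle_right p (lift K G n (G.src (anc K G n f))) q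
    have h4 := hδ.triangle_right p (lift K G n (G.tgt (anc K G n f))) q
    have h5 := hF.long
    linarith
  have hs := hsum p hp
  have hn1 := hδ.nonneg p (lift K G n (G.src (anc K G n f)))
  have hn2 := hδ.nonneg p (lift K G n (G.tgt (anc K G n f)))
  rcases hF.exists_near hδ hσκ hκ hsum
    (fun t ht z hz => (isBoundary_singleton G (anc K G n f)).gd_eq hH ht hz) hp hq with
    (h | h) | (h | h)
  · exact ⟨f, _, hf, Or.inl rfl, h⟩
  · have h3 := hδ.triangle_right p (lift K G n (G.src (anc K G n f))) q
    have h5 := hF.long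
    linarith
  · exact ⟨f, _, hf, Or.inr rfl, h⟩
  · have h3 := hδ.triangle_right p (lift K G n (G.tgt (anc K G n f))) q
    have h5 := hF.long
    linarith

/-- The two new edges of the quadrilateral at the new vertex `w`. -/
theorem exists_edges_diamondInner (w : diamondGadget.W) :
    ∃ φ ψ : diamondGadget.F, diamondGadget.src φ = .first ∧ diamondGadget.tgt φ = .inner w ∧
      diamondGadget.src ψ = .inner w ∧ diamondGadget.tgt ψ = .second ∧
      ∀ χ, diamondGadget.src χ = .inner w ∨ diamondGadget.tgt χ = .inner w → χ = φ ∨ χ = ψ := by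
  rcases w with _ | _
  · refine ⟨.ua, .av, rfl, rfl, rfl, rfl, ?_⟩
    rintro (_ | _ | _ | _) (h | h) <;> simp_all [diamondGadget]
  · refine ⟨.ub, .bv, rfl, rfl, rfl, rfl, ?_⟩
    rintro (_ | _ | _ | _) (h | h) <;> simp_all [diamondGadget]

theorem eq_of_inr_eq_place {G : EdgeGraph} {W : Type} {e e' : G.E} {w : W} {x : GadgetVertex W}
    (h : Sum.inr (e, w) = G.place W e' x) : e' = e ∧ x = .inner w := by
  rcases x with _ | _ | x
  · cases h
  · cases h
  · cases h
    exact ⟨rfl, rfl⟩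

/-- In a diamond graph, a fork that is longer than the cells of some level but not much longer
than those of the next coarser level starts close to a vertex of the coarser level. -/
theorem exists_near_old {G : EdgeGraph} (hG : G.Good) (n : ℕ) {σ κ θ : ℝ} (hσκ : σ ≤ κ)
    (hκ : 0 ≤ κ + σ) {u p q : (iter diamondGadget G (n + 1)).V}
    {A B : Set (iter diamondGadget G (n + 1)).V}
    (hF : IsFork (iter diamondGadget G (n + 1)).gd σ κ θ u p q A B)
    (hn : (2 : ℝ) ^ n < θ - 2 * (κ + σ)) (hn1 : θ - 2 * (κ + σ) ≤ (2 : ℝ) ^ (n + 1))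
    (hθ : 6 * (κ + σ) < θ) :
    ∃ v : G.V, (iter diamondGadget G (n + 1)).gd p (lift diamondGadget G (n + 1) v) ≤ κ + σ := by
  have hG' := hG.replaceEdges diamondGraded
  set H := iter diamondGadget (G.replaceEdges diamondGadget) n
  set ι := lift diamondGadget (G.replaceEdges diamondGadget) n
  have hH : H.Good := hG'.iter diamondGraded n
  have hδ := hH.isPseudoDist
  obtain ⟨f, a, hfp, hfa, hpa⟩ : ∃ (f : H.E) (a : (G.replaceEdges diamondGadget).V),
      H.IsEnd f p ∧ (G.replaceEdges diamondGadget).IsEnd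
        (anc diamondGadget (G.replaceEdges diamondGadget) n f) a ∧
      H.gd p (ι a) ≤ κ + σ := exists_near_lift hG' diamondGraded n hσκ hκ hF
    (by push_cast; linarith)
  rcases a with v | ⟨e, w⟩
  · exact ⟨v, hpa⟩
  -- If `p` is near a midpoint `w`, the two cells at `w` form a region with boundary at the old ends
  -- of `e`. These ends are at distance `2 ^ n` from `w`: too far to be near `p`, and too close to
  -- be near `q`.
  exfalso
  obtain ⟨φ, ψ, hφ1, hφ2, hψ1, hψ2, hχ⟩ := exists_edges_diamondInner w
  have srcφ : (G.replaceEdges diamondGadget).src (e, φ) = Sum.inl (G.src e) :=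
    congrArg (G.place _ e) hφ1
  have tgtφ : (G.replaceEdges diamondGadget).tgt (e, φ) = Sum.inr (e, w) :=
    congrArg (G.place _ e) hφ2
  have srcψ : (G.replaceEdges diamondGadget).src (e, ψ) = Sum.inr (e, w) :=
    congrArg (G.place _ e) hψ1
  have tgtψ : (G.replaceEdges diamondGadget).tgt (e, ψ) = Sum.inl (G.tgt e) :=
    congrArg (G.place _ e) hψ2
  have star : ∀ e', (G.replaceEdges diamondGadget).IsEnd e' (Sum.inr (e, w)) →
      e' = (e, φ) ∨ e' = (e, ψ) := by
    rintro ⟨e', χ⟩ (h | h)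
    · obtain ⟨rfl, h'⟩ := eq_of_inr_eq_place h
      exact (hχ χ (Or.inl h')).imp (congrArg _) (congrArg _)
    · obtain ⟨rfl, h'⟩ := eq_of_inr_eq_place h
      exact (hχ χ (Or.inr h')).imp (congrArg _) (congrArg _)
  have hB : (G.replaceEdges diamondGadget).IsBoundary {(e, φ), (e, ψ)}
      (Sum.inl (G.src e)) (Sum.inl (G.tgt e)) := by
    intro e₁ h₁ e₂ h₂ z hz hz'
    have hne : z ≠ Sum.inr (e, w) := by
      rintro rfl
      exact h₂ (star e₂ hz')
    rcases h₁ with rfl | rfl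
    · rcases hz with h | h
      · exact Or.inl (h.trans srcφ)
      · exact absurd (h.trans tgtφ) hne
    · rcases hz with h | h
      · exact absurd (h.trans srcψ) hne
      · exact Or.inr (h.trans tgtψ)
  have hax : H.gd (ι (Sum.inr (e, w))) (ι (Sum.inl (G.src e))) = 2 ^ n := by
    have h1 := gd_lift_ends hG' diamondGraded n (e, φ)
    rw [srcφ, tgtφ] at h1
    rw [hδ.comm]
    exact_mod_cast h1
  have hay : H.gd (ι (Sum.inr (e, w))) (ι (Sum.inl (G.tgt e))) = 2 ^ n := by
    have h1 := gd_lift_ends hG' diamondGraded n (e, ψ)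
    rw [srcψ, tgtψ] at h1
    exact_mod_cast h1
  have hxy : H.gd (ι (Sum.inl (G.src e))) (ι (Sum.inl (G.tgt e))) = 2 ^ (n + 1) := by
    exact_mod_cast gd_lift_ends hG diamondGraded (n + 1) e
  have hT : ∀ t ∈ region diamondGadget (G.replaceEdges diamondGadget) n {(e, φ), (e, ψ)},
      H.gd t (ι (Sum.inl (G.src e))) + H.gd t (ι (Sum.inl (G.tgt e))) = 2 ^ (n + 1) ∧
      H.gd t (ι (Sum.inr (e, w))) ≤ 2 ^ n := by
    rintro t ⟨f', hf', ht⟩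
    have t1 := hδ.triangle_left (ι (Sum.inl (G.src e))) t (ι (Sum.inl (G.tgt e)))
    have n1 := hδ.nonneg t (ι (Sum.inl (G.src e)))
    have n2 := hδ.nonneg t (ι (Sum.inl (G.tgt e)))
    rcases hf' with hf' | hf'
    · have h1 : H.gd t (ι (Sum.inl (G.src e))) + H.gd t (ι (Sum.inr (e, w))) = 2 ^ n := by
        rw [← srcφ, ← tgtφ]
        exact_mod_cast gd_add_gd_of_isEnd hG' diamondGraded n hf' ht
      have h2 := hδ.triangle t (ι (Sum.inr (e, w))) (ι (Sum.inl (G.tgt e)))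
      rw [pow_succ] at hxy ⊢
      constructor <;> linarith
    · have h1 : H.gd t (ι (Sum.inr (e, w))) + H.gd t (ι (Sum.inl (G.tgt e))) = 2 ^ n := by
        rw [← srcψ, ← tgtψ]
        exact_mod_cast gd_add_gd_of_isEnd hG' diamondGraded n hf' ht
      have h2 := hδ.triangle t (ι (Sum.inr (e, w))) (ι (Sum.inl (G.src e)))
      rw [pow_succ] at hxy ⊢
      constructor <;> linarith
  have hp : p ∈ region diamondGadget (G.replaceEdges diamondGadget) n {(e, φ), (e, ψ)} :=
    ⟨f, star _ hfa, hfp⟩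
  have hlong : θ ≤ H.gd p q := hF.long
  have hpa' : H.gd p (ι (Sum.inr (e, w))) ≤ κ + σ := hpa
  have tpq := hδ.triangle_right p (ι (Sum.inr (e, w))) q
  have hq : q ∉ region diamondGadget (G.replaceEdges diamondGadget) n {(e, φ), (e, ψ)} := by
    intro hq
    have h1 := (hT q hq).2
    linarith
  rw [pow_succ] at hn1
  have fin : ∀ s, H.gd (ι (Sum.inr (e, w))) s = 2 ^ n →
      H.gd p s ≤ κ + σ ∨ H.gd q s ≤ κ + σ → False := by
    rintro s hs (h | h)
    · have h1 := hδ.triangle_left (ι (Sum.inr (e, w))) p s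
      linarith
    · have h1 := hδ.triangle_right q s (ι (Sum.inr (e, w)))
      linarith
  exact (hF.exists_near hδ hσκ hκ (fun t ht => (hT t ht).1)
    (fun t ht z hz => hB.gd_eq hH ht hz) hp hq).elim (fin _ hax) (fin _ hay)

/-- In a diamond graph there are no two forks that are long compared with the distance of their
starting points. -/
theorem not_isFork_and_isFork {G : EdgeGraph} (hG : G.Good) (n : ℕ) {σ κ θ : ℝ} (hσκ : σ ≤ κ)
    (hκ : 0 ≤ κ + σ) {u p q u' p' q' : (iter diamondGadget G n).V}
    {A B A' B' : Set (iter diamondGadget G n).V}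
    (hF : IsFork (iter diamondGadget G n).gd σ κ θ u p q A B)
    (hF' : IsFork (iter diamondGadget G n).gd σ κ θ u' p' q' A' B')
    (hn : θ - 2 * (κ + σ) ≤ (2 : ℝ) ^ n)
    (hθ1 : 1 < θ - 2 * (κ + σ)) (hθ : 6 * (κ + σ) < θ)
    (hpp : 2 * (κ + σ) < (iter diamondGadget G n).gd p p')
    (hpp' : (iter diamondGadget G n).gd p p' + 4 * (κ + σ) < θ) : False := by
  induction n generalizing G with
  | zero =>
    rw [pow_zero] at hn
    linarith
  | succ n ih =>
    -- The induction descends to the level with `2 ^ n < θ - 2 * (κ + σ) ≤ 2 ^ (n + 1)`.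
    by_cases h : (2 : ℝ) ^ n < θ - 2 * (κ + σ)
    · obtain ⟨v, hv⟩ := exists_near_old hG n hσκ hκ hF h hn hθ
      obtain ⟨v', hv'⟩ := exists_near_old hG n hσκ hκ hF' h hn hθ
      have hδ := (hG.iter diamondGraded (n + 1)).isPseudoDist
      by_cases hvv : v = v'
      · subst hvv
        have h1 := hδ.triangle_right p (lift diamondGadget G (n + 1) v) p'
        linarith
      -- Distinct vertices of `G` are at least `2 ^ (n + 1)` apart, more than `p`, `p'` and the two
      -- errors allow.
      · have h1 := gd_lift hG diamondGraded (n + 1) v v'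
        have h2 := hG.one_le_gd hvv
        have h3 : (0 : ℝ) < ((2 : ℕ) : ℝ) ^ (n + 1) := by positivity
        have h4 := mul_le_mul_of_nonneg_left h2 h3.le
        rw [mul_one, ← h1] at h4
        push_cast at h4
        have h5 := hδ.triangle_left (lift diamondGadget G (n + 1) v) p
          (lift diamondGadget G (n + 1) v')
        have h6 := hδ.triangle p p' (lift diamondGadget G (n + 1) v')
        linarith
    · exact ih (hG.replaceEdges diamondGraded) hF hF' (not_lt.1 h) hpp hpp'

end EdgeGraph

/-! ### The two arms of a Laakso cell and their images. -/

namespace EdgeGraph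

/-- `χ` and `ψ` are the two edges of a path from `p` to `q` in the Laakso graph of level one, and
`w` is the vertex between them. -/
structure IsLaaksoArm (χ ψ : laaksoGadget.F) (w : laaksoGadget.W) : Prop where
  src_left : laaksoGadget.src χ = .inner .p
  tgt_left : laaksoGadget.tgt χ = .inner w
  src_right : laaksoGadget.src ψ = .inner w
  tgt_right : laaksoGadget.tgt ψ = .inner .q
  eq_or_eq : ∀ φ, laaksoGadget.src φ = .inner w ∨ laaksoGadget.tgt φ = .inner w → φ = χ ∨ φ = ψ

theorem isLaaksoArm_c : IsLaaksoArm .pc .cq .c := by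
  refine ⟨rfl, rfl, rfl, rfl, ?_⟩
  rintro (_ | _ | _ | _ | _ | _) (h | h) <;> simp_all [laaksoGadget]

theorem isLaaksoArm_d : IsLaaksoArm .pd .dq .d := by
  refine ⟨rfl, rfl, rfl, rfl, ?_⟩
  rintro (_ | _ | _ | _ | _ | _) (h | h) <;> simp_all [laaksoGadget]

/-- The region of an iterated Laakso graph over the edges `χ` and `ψ` of the cell of `e`. -/
abbrev arm (G : EdgeGraph) (n : ℕ) (e : G.E) (χ ψ : laaksoGadget.F) :
    Set (iter laaksoGadget (G.replaceEdges laaksoGadget) n).V :=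
  region laaksoGadget (G.replaceEdges laaksoGadget) n {(e, χ), (e, ψ)}

/-- The vertex `w` of the copy of the Laakso graph of level one over the edge `e`. -/
abbrev liftInner (G : EdgeGraph) (n : ℕ) (e : G.E) (w : laaksoGadget.W) :
    (iter laaksoGadget (G.replaceEdges laaksoGadget) n).V :=
  lift laaksoGadget (G.replaceEdges laaksoGadget) n (Sum.inr (e, w))

variable {G : EdgeGraph} {χ ψ : laaksoGadget.F} {w : laaksoGadget.W}

/-- The middle vertex `w` of an arm meets no edges but the two of the arm, so only `p` and `q` can
be shared. -/
theorem IsLaaksoArm.isBoundary (h : IsLaaksoArm χ ψ w) (e : G.E) :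
    (G.replaceEdges laaksoGadget).IsBoundary {(e, χ), (e, ψ)} (Sum.inr (e, .p))
      (Sum.inr (e, .q)) := by
  rintro e₁ h₁ ⟨e₂, φ⟩ h₂ z hz hz'
  have hne : z ≠ Sum.inr (e, w) := by
    rintro rfl
    have key : e₂ = e ∧ (φ = χ ∨ φ = ψ) := by
      rcases hz' with hz' | hz'
      · obtain ⟨h3, h4⟩ := eq_of_inr_eq_place hz'
        exact ⟨h3, h.eq_or_eq φ (Or.inl h4)⟩
      · obtain ⟨h3, h4⟩ := eq_of_inr_eq_place hz'
        exact ⟨h3, h.eq_or_eq φ (Or.inr h4)⟩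
    obtain ⟨rfl, rfl | rfl⟩ := key
    · exact h₂ (Or.inl rfl)
    · exact h₂ (Or.inr rfl)
  rcases h₁ with rfl | rfl
  · rcases hz with hz | hz
    · exact Or.inl (hz.trans (congrArg (G.place _ e) h.src_left))
    · exact absurd (hz.trans (congrArg (G.place _ e) h.tgt_left)) hne
  · rcases hz with hz | hz
    · exact absurd (hz.trans (congrArg (G.place _ e) h.src_right)) hne
    · exact Or.inr (hz.trans (congrArg (G.place _ e) h.tgt_right))

theorem IsLaaksoArm.exists_crossing_edge (h : IsLaaksoArm χ ψ w) (n : ℕ) (e : G.E)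
    (T : Set (iter laaksoGadget (G.replaceEdges laaksoGadget) n).V)
    (hp : liftInner G n e .p ∈ T) (hq : liftInner G n e .q ∉ T) :
    ∃ f, (anc laaksoGadget (G.replaceEdges laaksoGadget) n f = (e, χ) ∨
      anc laaksoGadget (G.replaceEdges laaksoGadget) n f = (e, ψ)) ∧
      (iter laaksoGadget (G.replaceEdges laaksoGadget) n).src f ∈ T ∧
      (iter laaksoGadget (G.replaceEdges laaksoGadget) n).tgt f ∉ T := by
  have s1 : (G.replaceEdges laaksoGadget).src (e, χ) = Sum.inr (e, .p) :=
    congrArg (G.place _ e) h.src_left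
  have t1 : (G.replaceEdges laaksoGadget).tgt (e, χ) = Sum.inr (e, w) :=
    congrArg (G.place _ e) h.tgt_left
  have s2 : (G.replaceEdges laaksoGadget).src (e, ψ) = Sum.inr (e, w) :=
    congrArg (G.place _ e) h.src_right
  have t2 : (G.replaceEdges laaksoGadget).tgt (e, ψ) = Sum.inr (e, .q) :=
    congrArg (G.place _ e) h.tgt_right
  by_cases hw : liftInner G n e w ∈ T
  · obtain ⟨f, hf, h1, h2⟩ := EdgeGraph.exists_crossing_edge laaksoGraded n (e, ψ) T
      (by rw [s2]; exact hw) (by rw [t2]; exact hq)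
    exact ⟨f, Or.inr hf, h1, h2⟩
  · obtain ⟨f, hf, h1, h2⟩ := EdgeGraph.exists_crossing_edge laaksoGraded n (e, χ) T
      (by rw [s1]; exact hp) (by rw [t1]; exact hw)
    exact ⟨f, Or.inl hf, h1, h2⟩

/-- The points of an arm lie, up to pseudo-distances that are bounded by `c` on its edges, on a
path from `p` to `q` of length `2 * c * 4 ^ n`. -/
theorem IsLaaksoArm.exists_split (h : IsLaaksoArm χ ψ w) (n : ℕ) (e : G.E)
    {δ : (iter laaksoGadget G (n + 1)).V → (iter laaksoGadget G (n + 1)).V → ℝ}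
    (hδ : IsPseudoDist δ) {c : ℝ}
    (hc : ∀ f, anc laaksoGadget G (n + 1) f = e →
      δ ((iter laaksoGadget G (n + 1)).src f) ((iter laaksoGadget G (n + 1)).tgt f) ≤ c)
    {z : (iter laaksoGadget G (n + 1)).V} (hz : z ∈ arm G n e χ ψ) :
    ∃ s, δ (liftInner G n e .p) z ≤ s ∧ δ z (liftInner G n e .q) ≤ 2 * (c * 4 ^ n) - s := by
  have s1 : (G.replaceEdges laaksoGadget).src (e, χ) = Sum.inr (e, .p) :=
    congrArg (G.place _ e) h.src_left
  have t1 : (G.replaceEdges laaksoGadget).tgt (e, χ) = Sum.inr (e, w) :=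
    congrArg (G.place _ e) h.tgt_left
  have s2 : (G.replaceEdges laaksoGadget).src (e, ψ) = Sum.inr (e, w) :=
    congrArg (G.place _ e) h.src_right
  have t2 : (G.replaceEdges laaksoGadget).tgt (e, ψ) = Sum.inr (e, .q) :=
    congrArg (G.place _ e) h.tgt_right
  have h1 := lift_ends_le (G := G.replaceEdges laaksoGadget) laaksoGraded n (e, χ) hδ
    fun f' hf' => hc f' (congrArg Prod.fst hf')
  have h2 := lift_ends_le (G := G.replaceEdges laaksoGadget) laaksoGraded n (e, ψ) hδ
    fun f' hf' => hc f' (congrArg Prod.fst hf')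
  rw [s1, t1] at h1
  rw [s2, t2] at h2
  push_cast at h1 h2
  obtain ⟨f, hf | hf, hz⟩ := hz
  · obtain ⟨s, h3, h4⟩ := EdgeGraph.exists_split (G := G.replaceEdges laaksoGadget)
      laaksoGraded n hf hz hδ fun f' hf' => hc f' (congrArg Prod.fst hf')
    rw [s1] at h3
    rw [t1] at h4
    push_cast at h4
    refine ⟨s, h3, (hδ.triangle _ _ _).trans ((add_le_add h4 h2).trans (le_of_eq (by ring)))⟩
  · obtain ⟨s, h3, h4⟩ := EdgeGraph.exists_split (G := G.replaceEdges laaksoGadget)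
      laaksoGraded n hf hz hδ fun f' hf' => hc f' (congrArg Prod.fst hf')
    rw [s2] at h3
    rw [t2] at h4
    push_cast at h4
    exact ⟨c * 4 ^ n + s, (hδ.triangle _ _ _).trans (add_le_add h1 h3),
      h4.trans (le_of_eq (by ring))⟩

/-- A geodesic from one arm to the other passes through `p` or `q`. This is the source of the
separation of forks. -/
theorem gd_le_of_mem_arms (hG : G.Good) (n : ℕ) (e : G.E)
    {z z' : (iter laaksoGadget G (n + 1)).V} (hz : z ∈ arm G n e .pc .cq)
    (hz' : z' ∈ arm G n e .pd .dq) :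
    (iter laaksoGadget G (n + 1)).gd z (liftInner G n e .p) ≤
        (iter laaksoGadget G (n + 1)).gd z z' ∨
      (iter laaksoGadget G (n + 1)).gd z (liftInner G n e .q) ≤
        (iter laaksoGadget G (n + 1)).gd z z' := by
  have hH := (hG.replaceEdges laaksoGraded).iter laaksoGraded n
  have hδ := hH.isPseudoDist
  have hB := isLaaksoArm_c.isBoundary e
  -- A point common to both arms is `p` or `q` itself.
  by_cases hmem : z' ∈ arm G n e .pc .cq
  · have hc : z' ∈ region laaksoGadget (G.replaceEdges laaksoGadget) n
        {(e, LaaksoEdge.pc), (e, LaaksoEdge.cq)}ᶜ := by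
      obtain ⟨f, hf, hfz⟩ := hz'
      refine ⟨f, ?_, hfz⟩
      rintro (h | h) <;> rcases hf with hf | hf <;>
        exact LaaksoEdge.noConfusion (congrArg Prod.snd (hf.symm.trans h))
    rcases hB.eq_of_mem n hmem hc with rfl | rfl
    · exact Or.inl le_rfl
    · exact Or.inr le_rfl
  · rcases hB.gd_eq hH hz hmem with h | h
    · exact Or.inl ((le_add_of_nonneg_right (hδ.nonneg _ _)).trans h.ge)
    · exact Or.inr ((le_add_of_nonneg_right (hδ.nonneg _ _)).trans h.ge)

/-- A bilipschitz map of an iterated Laakso graph that is nearly geodesic on the cell of an edge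
`e` maps the two arms over `e` to forks, starting from either end. -/
theorem isFork_arms (hG : G.Good) (n : ℕ) (e : G.E) {X : Type*} {δ : X → X → ℝ}
    (hδ : IsPseudoDist δ) (F : (iter laaksoGadget G (n + 1)).V → X) {r C W : ℝ} (hr : 0 < r)
    (hC : 1 ≤ C) (hW : 0 < W)
    (hF : ∀ z z', r * (iter laaksoGadget G (n + 1)).gd z z' ≤ δ (F z) (F z') ∧
      δ (F z) (F z') ≤ r * C * (iter laaksoGadget G (n + 1)).gd z z')
    (hc : ∀ f, anc laaksoGadget G (n + 1) f = e →
      δ (F ((iter laaksoGadget G (n + 1)).src f)) (F ((iter laaksoGadget G (n + 1)).tgt f)) ≤ W)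
    (hlong : (4 ^ (n + 1) - 1) * W ≤
      δ (F (lift laaksoGadget G (n + 1) (G.src e))) (F (lift laaksoGadget G (n + 1) (G.tgt e))))
    (hn : (4 : ℝ) < 4 ^ n) :
    IsFork δ W (2 * C * W) ((2 * 4 ^ n - 1) * W) (F (lift laaksoGadget G (n + 1) (G.src e)))
        (F (liftInner G n e .p)) (F (liftInner G n e .q)) (F '' arm G n e .pc .cq)
        (F '' arm G n e .pd .dq) ∧
      IsFork δ W (2 * C * W) ((2 * 4 ^ n - 1) * W) (F (lift laaksoGadget G (n + 1) (G.tgt e)))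
        (F (liftInner G n e .q)) (F (liftInner G n e .p)) (F '' arm G n e .pc .cq)
        (F '' arm G n e .pd .dq) := by
  have hΔ := hδ.comap F
  have hSP : δ (F (lift laaksoGadget G (n + 1) (G.src e))) (F (liftInner G n e .p)) ≤
      W * 4 ^ n := by
    exact_mod_cast lift_ends_le (G := G.replaceEdges laaksoGadget) laaksoGraded n
      (e, LaaksoEdge.up) hΔ fun f' hf' => hc f' (congrArg Prod.fst hf')
  have hQE : δ (F (liftInner G n e .q)) (F (lift laaksoGadget G (n + 1) (G.tgt e))) ≤
      W * 4 ^ n := by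
    exact_mod_cast lift_ends_le (G := G.replaceEdges laaksoGadget) laaksoGraded n
      (e, LaaksoEdge.qv) hΔ fun f' hf' => hc f' (congrArg Prod.fst hf')
  have armC := fun z hz => isLaaksoArm_c.exists_split (z := z) n e hΔ hc hz
  have armD := fun z hz => isLaaksoArm_d.exists_split (z := z) n e hΔ hc hz
  have hPQ : δ (F (liftInner G n e .p)) (F (liftInner G n e .q)) ≤ 2 * (W * 4 ^ n) := by
    have h1 := lift_ends_le (G := G.replaceEdges laaksoGadget) laaksoGraded n
      (e, LaaksoEdge.pc) hΔ fun f' hf' => hc f' (congrArg Prod.fst hf')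
    have h2 := lift_ends_le (G := G.replaceEdges laaksoGadget) laaksoGraded n
      (e, LaaksoEdge.cq) hΔ fun f' hf' => hc f' (congrArg Prod.fst hf')
    push_cast at h1 h2
    exact (hδ.triangle _ _ _).trans ((add_le_add h1 h2).trans (le_of_eq (by ring)))
  rw [pow_succ] at hlong
  -- The stem has length at least `(4 ^ n - 1) * W`, and this must exceed `3 * W`.
  have hWn : 4 * W < W * 4 ^ n := by
    rw [mul_comm 4 W]
    exact mul_lt_mul_of_pos_left hn hW
  -- The path between the ends of the cell via `p`, `z` and `q` has length bounds adding up to `4 ^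
  -- (n + 1) * W`, only `W` more than the distance of its ends; so no part of it can fall short of
  -- being geodesic by more than `W`.
  have geo : ∀ z s, δ (F (liftInner G n e .p)) (F z) ≤ s →
      δ (F z) (F (liftInner G n e .q)) ≤ 2 * (W * 4 ^ n) - s →
      (δ (F (lift laaksoGadget G (n + 1) (G.src e))) (F (liftInner G n e .p)) +
        δ (F (liftInner G n e .p)) (F z) ≤
        δ (F (lift laaksoGadget G (n + 1) (G.src e))) (F z) + W) ∧
      (δ (F (lift laaksoGadget G (n + 1) (G.tgt e))) (F (liftInner G n e .q)) +
        δ (F (liftInner G n e .q)) (F z) ≤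
        δ (F (lift laaksoGadget G (n + 1) (G.tgt e))) (F z) + W) := by
    intro z s h1 h2
    have t1 := hδ.triangle (F (lift laaksoGadget G (n + 1) (G.src e))) (F z)
      (F (lift laaksoGadget G (n + 1) (G.tgt e)))
    have t2 := hδ.triangle (F z) (F (liftInner G n e .q))
      (F (lift laaksoGadget G (n + 1) (G.tgt e)))
    have t3 := hδ.triangle (F (lift laaksoGadget G (n + 1) (G.src e))) (F (liftInner G n e .p))
      (F z)
    rw [hδ.comm (F (lift laaksoGadget G (n + 1) (G.tgt e))) (F (liftInner G n e .q)),
      hδ.comm (F (liftInner G n e .q)) (F z),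
      hδ.comm (F (lift laaksoGadget G (n + 1) (G.tgt e))) (F z)]
    constructor <;> linarith
  have sep : ∀ z ∈ arm G n e .pc .cq, ∀ z' ∈ arm G n e .pd .dq, δ (F z) (F z') ≤ 2 * W →
      δ (F (liftInner G n e .p)) (F z) ≤ 2 * C * W ∨
      δ (F (liftInner G n e .q)) (F z) ≤ 2 * C * W := by
    intro z hz z' hz' h
    have key : ∀ y, (iter laaksoGadget G (n + 1)).gd z y ≤
        (iter laaksoGadget G (n + 1)).gd z z' → δ (F y) (F z) ≤ 2 * C * W := by
      intro y hy
      have h1 := (hF z y).2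
      have h2 := (hF z z').1
      rw [hδ.comm (F y)]
      calc δ (F z) (F y) ≤ r * C * (iter laaksoGadget G (n + 1)).gd z y := h1
        _ ≤ r * C * (iter laaksoGadget G (n + 1)).gd z z' :=
          mul_le_mul_of_nonneg_left hy (by positivity)
        _ = C * (r * (iter laaksoGadget G (n + 1)).gd z z') := by ring
        _ ≤ C * (2 * W) := mul_le_mul_of_nonneg_left (h2.trans h) (by positivity)
        _ = 2 * C * W := by ring
    exact (gd_le_of_mem_arms hG n e hz hz').imp (key _) (key _)
  have t1 := hδ.triangle (F (lift laaksoGadget G (n + 1) (G.src e))) (F (liftInner G n e .p))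
    (F (lift laaksoGadget G (n + 1) (G.tgt e)))
  have t2 := hδ.triangle (F (liftInner G n e .p)) (F (liftInner G n e .q))
    (F (lift laaksoGadget G (n + 1) (G.tgt e)))
  have chain : ∀ {χ ψ w}, IsLaaksoArm χ ψ w → ∀ T : Set X, F (liftInner G n e .p) ∈ T →
      F (liftInner G n e .q) ∉ T → ∃ z ∈ F '' arm G n e χ ψ, ∃ z' ∈ F '' arm G n e χ ψ,
        z ∈ T ∧ z' ∉ T ∧ δ z z' ≤ W := by
    intro χ ψ w h T hp hq
    obtain ⟨f, hf, h1, h2⟩ := h.exists_crossing_edge n e (F ⁻¹' T) hp hq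
    exact ⟨_, ⟨_, ⟨f, hf, Or.inl rfl⟩, rfl⟩, _, ⟨_, ⟨f, hf, Or.inr rfl⟩, rfl⟩, h1, h2,
      hc f (hf.elim (fun h => congrArg Prod.fst h) fun h => congrArg Prod.fst h)⟩
  have up : ∀ {χ ψ w}, IsLaaksoArm χ ψ w → ∀ T : Set X, F (liftInner G n e .p) ∈ T →
      F (liftInner G n e .q) ∉ T → ∃ z ∈ F '' arm G n e χ ψ, ∃ z', z' ∉ T ∧ z ∈ T ∧
        δ z z' ≤ W := by
    intro χ ψ w h T hp hq
    obtain ⟨z, hz, z', -, h1, h2, h3⟩ := chain h T hp hq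
    exact ⟨z, hz, z', h2, h1, h3⟩
  have down : ∀ {χ ψ w}, IsLaaksoArm χ ψ w → ∀ T : Set X, F (liftInner G n e .q) ∈ T →
      F (liftInner G n e .p) ∉ T → ∃ z ∈ F '' arm G n e χ ψ, ∃ z', z' ∉ T ∧ z ∈ T ∧
        δ z z' ≤ W := by
    intro χ ψ w h T hp hq
    -- A chain is reversed by crossing the complement and exchanging the ends of the step.
    obtain ⟨z, -, z', hz, h1, h2, h3⟩ := chain h Tᶜ hq (fun hh => hh hp)
    exact ⟨z', hz, z, h1, not_not.1 h2, (hδ.comm _ _).trans_le h3⟩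
  refine ⟨⟨by linarith, by linarith, up isLaaksoArm_c, up isLaaksoArm_d, ?_, ?_, ?_⟩,
    ⟨?_, ?_, down isLaaksoArm_c, down isLaaksoArm_d, ?_, ?_, ?_⟩⟩
  · rintro _ ⟨z, hz, rfl⟩
    obtain ⟨s, h1, h2⟩ := armC z hz
    exact (geo z s h1 h2).1
  · rintro _ ⟨z, hz, rfl⟩
    obtain ⟨s, h1, h2⟩ := armD z hz
    exact (geo z s h1 h2).1
  · rintro _ ⟨z, hz, rfl⟩ _ ⟨z', hz', rfl⟩ h
    exact sep z hz z' hz' h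
  · rw [hδ.comm]
    linarith
  · rw [hδ.comm]
    linarith
  · rintro _ ⟨z, hz, rfl⟩
    obtain ⟨s, h1, h2⟩ := armC z hz
    exact (geo z s h1 h2).2
  · rintro _ ⟨z, hz, rfl⟩
    obtain ⟨s, h1, h2⟩ := armD z hz
    exact (geo z s h1 h2).2
  · rintro _ ⟨z, hz, rfl⟩ _ ⟨z', hz', rfl⟩ h
    exact (sep z hz z' hz' h).symm

end EdgeGraph

/-- Serves to give two forks of different lengths a common `θ`. -/
theorem IsFork.mono {X : Type*} {δ : X → X → ℝ} {σ κ θ θ' : ℝ} {u p q : X} {A B : Set X}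
    (h : IsFork δ σ κ θ u p q A B) (hθ : θ' ≤ θ) : IsFork δ σ κ θ' u p q A B :=
  { h with long := hθ.trans h.long }

/-! ### Two forks in a nearly geodesic cell. -/

namespace EdgeGraph

/-- For diamond graphs, this diameter bound ensures that the search for the level matching a fork
can start at the top. -/
theorem gd_le_iter_singleEdge {K : Gadget} {b : ℕ} (hK : K.Graded b) (n : ℕ)
    (u v : (iter K singleEdge n).V) : (iter K singleEdge n).gd u v ≤ (b : ℝ) ^ n := by
  have hH := singleEdge_good.iter hK n
  have hδ := hH.isPseudoDist
  by_cases huv : u = v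
  · rw [huv, hδ.self]
    positivity
  · obtain ⟨f, hf⟩ := hH.exists_isEnd huv
    obtain ⟨f', hf'⟩ := hH.exists_isEnd (Ne.symm huv)
    have h1 := gd_add_gd_of_isEnd singleEdge_good hK n (e := ()) rfl hf
    have h2 := gd_add_gd_of_isEnd singleEdge_good hK n (e := ()) rfl hf'
    have h3 := hδ.triangle_right u (lift K singleEdge n (singleEdge.src ())) v
    have h4 := hδ.triangle_right u (lift K singleEdge n (singleEdge.tgt ())) v
    linarith

/-- A bilipschitz map from an iterated Laakso graph to a diamond graph is not nearly geodesic on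
any cell. -/
theorem false_of_nearly_geodesic {G : EdgeGraph} (hG : G.Good) (n m : ℕ) (e : G.E)
    (F : (iter laaksoGadget G (n + 2)).V → (iter diamondGadget singleEdge m).V) {r C W : ℝ}
    (hr : 0 < r) (hC : 1 ≤ C) (hn : 8 * C + 10 ≤ (4 : ℝ) ^ n)
    (hF : ∀ z z', r * (iter laaksoGadget G (n + 2)).gd z z' ≤
        (iter diamondGadget singleEdge m).gd (F z) (F z') ∧
      (iter diamondGadget singleEdge m).gd (F z) (F z') ≤
        r * C * (iter laaksoGadget G (n + 2)).gd z z')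
    (hc : ∀ f, anc laaksoGadget G (n + 2) f = e → (iter diamondGadget singleEdge m).gd
      (F ((iter laaksoGadget G (n + 2)).src f)) (F ((iter laaksoGadget G (n + 2)).tgt f)) ≤ W)
    (hlong : (4 ^ (n + 2) - 1) * W ≤ (iter diamondGadget singleEdge m).gd
      (F (lift laaksoGadget G (n + 2) (G.src e))) (F (lift laaksoGadget G (n + 2) (G.tgt e)))) :
    False := by
  have hY := singleEdge_good.iter diamondGraded m
  have hδ := hY.isPseudoDist
  have hΔ := hδ.comap F
  have hG1 := hG.replaceEdges laaksoGraded
  -- Distances in the target are integers, so `W < 1` would collapse every edge of the cell, against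
  -- the lower bilipschitz bound.
  have hW : 1 ≤ W := by
    by_contra! hW
    have h0 : ∀ f, anc laaksoGadget G (n + 2) f = e → (iter diamondGadget singleEdge m).gd
        (F ((iter laaksoGadget G (n + 2)).src f))
        (F ((iter laaksoGadget G (n + 2)).tgt f)) ≤ 0 := by
      intro f hf
      by_cases h : F ((iter laaksoGadget G (n + 2)).src f) =
          F ((iter laaksoGadget G (n + 2)).tgt f)
      · rw [h, hδ.self]
      · exact absurd (hY.one_le_gd h) (not_le.2 ((hc f hf).trans_lt hW))
    have h1 := lift_ends_le laaksoGraded (n + 2) e hΔ h0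
    have h2 := (hF (lift laaksoGadget G (n + 2) (G.src e))
      (lift laaksoGadget G (n + 2) (G.tgt e))).1
    rw [gd_lift_ends hG laaksoGraded] at h2
    have h3 : 0 < r * ((4 : ℕ) : ℝ) ^ (n + 2) := by positivity
    linarith
  have hW0 : 0 < W := one_pos.trans_le hW
  have hCW : W ≤ C * W := le_mul_of_one_le_left hW0.le hC
  have hnW : (8 * C + 10) * W ≤ 4 ^ n * W := mul_le_mul_of_nonneg_right hn hW0.le
  have hc1 : ∀ f, anc laaksoGadget (G.replaceEdges laaksoGadget) (n + 1) f =
      (e, LaaksoEdge.up) → (iter diamondGadget singleEdge m).gd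
      (F ((iter laaksoGadget G (n + 2)).src f))
      (F ((iter laaksoGadget G (n + 2)).tgt f)) ≤ W :=
    fun f hf => hc f (congrArg Prod.fst hf)
  have hPE : (iter diamondGadget singleEdge m).gd (F (liftInner G (n + 1) e .p))
      (F (lift laaksoGadget G (n + 2) (G.tgt e))) ≤ W * 4 ^ (n + 1) * 3 := by
    have h := (path_le_lift_place laaksoGraded (n + 1) e hΔ (c := W * 4 ^ (n + 1)) (fun χ => by
      exact_mod_cast lift_ends_le (G := G.replaceEdges laaksoGadget) laaksoGraded (n + 1) (e, χ)
        hΔ fun f hf => hc f (congrArg Prod.fst hf)) (.inner .p)).2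
    exact h.trans (le_of_eq (by norm_num [laaksoGraded]))
  have hSq : (iter diamondGadget singleEdge m).gd
      (F (lift laaksoGadget G (n + 2) (G.src e)))
      (F (liftInner (G.replaceEdges laaksoGadget) n (e, LaaksoEdge.up) .q)) ≤ W * 4 ^ n * 3 := by
    have h := (path_le_lift_place (G := G.replaceEdges laaksoGadget) laaksoGraded n
      (e, LaaksoEdge.up) hΔ (c := W * 4 ^ n) (fun χ => by
      exact_mod_cast lift_ends_le (G := (G.replaceEdges laaksoGadget).replaceEdges laaksoGadget)
        laaksoGraded n ((e, LaaksoEdge.up), χ)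
        hΔ fun f hf => hc1 f (congrArg Prod.fst hf)) (.inner .q)).1
    exact h.trans (le_of_eq (by norm_num [laaksoGraded]))
  have hqP : (iter diamondGadget singleEdge m).gd
      (F (liftInner (G.replaceEdges laaksoGadget) n (e, LaaksoEdge.up) .q))
      (F (liftInner G (n + 1) e .p)) ≤ W * 4 ^ n := by
    exact_mod_cast lift_ends_le
      (G := (G.replaceEdges laaksoGadget).replaceEdges laaksoGadget)
      laaksoGraded n ((e, LaaksoEdge.up), LaaksoEdge.qv) hΔ
      fun f hf => hc1 f (congrArg Prod.fst hf)
  have e1 : (4 : ℝ) ^ (n + 1) = 4 * 4 ^ n := by rw [pow_succ]; ring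
  have e2 : (4 : ℝ) ^ (n + 2) = 16 * 4 ^ n := by rw [pow_succ, pow_succ]; ring
  have t1 := hδ.triangle (F (lift laaksoGadget G (n + 2) (G.src e)))
    (F (liftInner G (n + 1) e .p)) (F (lift laaksoGadget G (n + 2) (G.tgt e)))
  have t2 := hδ.triangle (F (lift laaksoGadget G (n + 2) (G.src e)))
    (F (liftInner (G.replaceEdges laaksoGadget) n (e, LaaksoEdge.up) .q))
    (F (liftInner G (n + 1) e .p))
  -- The edge `up` inherits near geodesicity with the same absolute error `W`, since the other three
  -- quarters have images of total length at most `3 * 4 ^ (n + 1) * W`.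
  have hlong1 : (4 ^ (n + 1) - 1) * W ≤ (iter diamondGadget singleEdge m).gd
      (F (lift laaksoGadget G (n + 2) (G.src e))) (F (liftInner G (n + 1) e .p)) := by
    rw [e1] at hPE ⊢
    rw [e2] at hlong
    linarith
  -- The first fork starts at `p` of the cell, the second at `q` of the subcell over `up`, pointing
  -- back. Their starting points are between `(4 ^ n - 1) * W` and `4 ^ n * W` apart, and both are
  -- longer than `θ = (2 * 4 ^ n - 1) * W` requires.
  have fork1 := (isFork_arms hG (n + 1) e hδ F hr hC hW0 hF hc hlong (by rw [e1]; linarith)).1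
  have fork2 := (isFork_arms hG1 n (e, LaaksoEdge.up) hδ F hr hC hW0 hF hc1 hlong1
    (by linarith)).2
  have hdiam := gd_le_iter_singleEdge diamondGraded m (F (liftInner G (n + 1) e .p))
    (F (liftInner G (n + 1) e .q))
  have hl := fork1.long
  push_cast at hdiam
  rw [e1] at hl hlong1
  rw [hδ.comm] at hqP
  rw [hδ.comm (F (liftInner (G.replaceEdges laaksoGadget) n (e, LaaksoEdge.up) .q))] at t2
  refine not_isFork_and_isFork singleEdge_good m (κ := 2 * C * W) (σ := W)
    (θ := (2 * 4 ^ n - 1) * W) ?_ ?_ (fork1.mono ?_) fork2 ?_ ?_ ?_ ?_ ?_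
  · linarith
  · linarith
  · rw [e1]
    linarith
  · linarith
  · linarith
  · linarith
  · linarith
  · linarith

/-! ### Increasing the stretch from block to block. -/

/-- The graph obtained from `G` by replacing edges `k * i` times, in `i` blocks. -/
def blockIter (K : Gadget) (k : ℕ) : EdgeGraph → ℕ → EdgeGraph
  | G, 0 => G
  | G, i + 1 => blockIter K k (iter K G k) i

/-- The vertices of `G` as vertices of the iterated replacement. -/
def blockLift (K : Gadget) (k : ℕ) : (G : EdgeGraph) → (i : ℕ) → G.V → (blockIter K k G i).V
  | _, 0 => id
  | G, i + 1 => fun v => blockLift K k (iter K G k) i (lift K G k v)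

theorem blockIter_eq (K : Gadget) (k : ℕ) (G : EdgeGraph) (i : ℕ) :
    blockIter K k G i = iter K G (k * i) := by
  induction i generalizing G with
  | zero => rfl
  | succ i ih => rw [blockIter, ih, iter_add, Nat.mul_succ, Nat.add_comm]

theorem gd_blockLift {K : Gadget} {b : ℕ} {G : EdgeGraph} (hG : G.Good) (hK : K.Graded b)
    (k i : ℕ) (u v : G.V) :
    (blockIter K k G i).gd (blockLift K k G i u) (blockLift K k G i v) =
      ((b : ℝ) ^ k) ^ i * G.gd u v := by
  induction i generalizing G with
  | zero => simp [blockIter, blockLift]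
  | succ i ih =>
    have h := ih (hG.iter hK k) (lift K G k u) (lift K G k v)
    rw [gd_lift hG hK, ← mul_assoc, ← pow_succ] at h
    exact h

/-- As long as the map is not nearly geodesic on a cell, a subcell is stretched more than the
cell is. -/
theorem false_of_stretched (n m : ℕ) {C : ℝ} (hC : 1 ≤ C) (hn : 8 * C + 10 ≤ (4 : ℝ) ^ n)
    (i : ℕ) {G : EdgeGraph} (hG : G.Good) (e : G.E)
    (F : (blockIter laaksoGadget (n + 2) G i).V → (iter diamondGadget singleEdge m).V)
    {r k : ℝ} (hr : 0 < r)
    (hF : ∀ z z', r * (blockIter laaksoGadget (n + 2) G i).gd z z' ≤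
        (iter diamondGadget singleEdge m).gd (F z) (F z') ∧
      (iter diamondGadget singleEdge m).gd (F z) (F z') ≤
        r * C * (blockIter laaksoGadget (n + 2) G i).gd z z')
    (he : k * (r * (4 ^ (n + 2)) ^ i) ≤ (iter diamondGadget singleEdge m).gd
      (F (blockLift laaksoGadget (n + 2) G i (G.src e)))
      (F (blockLift laaksoGadget (n + 2) G i (G.tgt e))))
    (hk : C < k * (4 ^ (n + 2) / (4 ^ (n + 2) - 1)) ^ i) : False := by
  induction i generalizing G k with
  | zero =>
    have h1 := (hF (G.src e) (G.tgt e)).2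
    have h2 : (blockIter laaksoGadget (n + 2) G 0).gd (G.src e) (G.tgt e) = 1 := hG.gd_ends e
    rw [h2, mul_one] at h1
    have h3 : k * (r * (4 ^ (n + 2)) ^ 0) ≤ r * C := he.trans h1
    rw [pow_zero, mul_one] at h3 hk
    have h4 := mul_lt_mul_of_pos_left hk hr
    linarith
  | succ i ih =>
    have hN : (1 : ℝ) < 4 ^ (n + 2) := one_lt_pow₀ (by norm_num) (by simp)
    have hN1 : (0 : ℝ) < 4 ^ (n + 2) - 1 := by linarith
    have hG1 := hG.iter laaksoGraded (n + 2)
    set D := (iter diamondGadget singleEdge m).gd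
      (F (blockLift laaksoGadget (n + 2) G (i + 1) (G.src e)))
      (F (blockLift laaksoGadget (n + 2) G (i + 1) (G.tgt e))) with hD
    by_cases hgood : ∀ f, anc laaksoGadget G (n + 2) f = e →
        (iter diamondGadget singleEdge m).gd
          (F (blockLift laaksoGadget (n + 2) (iter laaksoGadget G (n + 2)) i
            ((iter laaksoGadget G (n + 2)).src f)))
          (F (blockLift laaksoGadget (n + 2) (iter laaksoGadget G (n + 2)) i
            ((iter laaksoGadget G (n + 2)).tgt f))) ≤ D / (4 ^ (n + 2) - 1)
    -- Restricted to the vertices of one block, the map is bilipschitz with the same `C`, and `r` is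
    -- scaled by the length of the remaining cells.
    · refine false_of_nearly_geodesic hG n m e
        (fun v => F (blockLift laaksoGadget (n + 2) (iter laaksoGadget G (n + 2)) i v))
        (r := r * (4 ^ (n + 2)) ^ i) (by positivity) hC hn (fun z z' => ?_) hgood
        (mul_div_cancel₀ D hN1.ne').le
      have h := hF (blockLift laaksoGadget (n + 2) (iter laaksoGadget G (n + 2)) i z)
        (blockLift laaksoGadget (n + 2) (iter laaksoGadget G (n + 2)) i z')
      have h2 := gd_blockLift hG1 laaksoGraded (n + 2) i z z'
      push_cast at h2
      change _ * (blockIter laaksoGadget (n + 2) (iter laaksoGadget G (n + 2)) i).gd _ _ ≤ _ ∧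
        _ ≤ _ * (blockIter laaksoGadget (n + 2) (iter laaksoGadget G (n + 2)) i).gd _ _ at h
      rw [h2] at h
      exact ⟨(le_of_eq (by ring)).trans h.1, h.2.trans (le_of_eq (by ring))⟩
    · push Not at hgood
      obtain ⟨f, -, hf⟩ := hgood
      -- The subcell is shorter by the factor `4 ^ (n + 2)`, but its image loses less than a factor
      -- `4 ^ (n + 2) - 1`.
      refine ih hG1 f F hF (k := k * (4 ^ (n + 2) / (4 ^ (n + 2) - 1))) ?_ ?_
      · refine le_trans ?_ hf.le
        rw [le_div_iff₀ hN1]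
        refine le_trans (le_of_eq ?_) he
        field_simp
        ring
      · rw [mul_assoc, ← pow_succ']
        exact hk

/-! ### Conclusion for both normalizations. -/

theorem diamondGraph_eq_iter (n : ℕ) : diamondGraph n = iter diamondGadget singleEdge n := by
  induction n with
  | zero => rfl
  | succ n ih => rw [diamondGraph, ih, ← iter_replaceEdges, iter]

theorem laaksoGraph_eq_iter (n : ℕ) : laaksoGraph n = iter laaksoGadget singleEdge n := by
  induction n with
  | zero => rfl
  | succ n ih => rw [laaksoGraph, ih, ← iter_replaceEdges, iter]

/-- Here `n` makes the forks long compared with `C`, and `i` counts the blocks after which the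
stretch would exceed `C`; neither depends on the target level `m`. -/
theorem exists_laaksoGraph_not_bilipschitz {C : ℝ} (hC : 1 ≤ C) :
    ∃ n, ∀ (m : ℕ) (F : (laaksoGraph n).V → (diamondGraph m).V) (r : ℝ), 0 < r →
      ¬ ∀ z z', r * (laaksoGraph n).gd z z' ≤ (diamondGraph m).gd (F z) (F z') ∧
        (diamondGraph m).gd (F z) (F z') ≤ r * C * (laaksoGraph n).gd z z' := by
  obtain ⟨n, hn⟩ := pow_unbounded_of_one_lt (8 * C + 10) (show (1 : ℝ) < 4 by norm_num)
  have hN : (1 : ℝ) < 4 ^ (n + 2) := one_lt_pow₀ (by norm_num) (by simp)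
  have hq : (1 : ℝ) < 4 ^ (n + 2) / (4 ^ (n + 2) - 1) := by
    rw [one_lt_div (by linarith)]
    linarith
  obtain ⟨i, hi⟩ := pow_unbounded_of_one_lt C hq
  refine ⟨(n + 2) * i, fun m => ?_⟩
  rw [laaksoGraph_eq_iter, ← blockIter_eq, diamondGraph_eq_iter]
  intro F r hr hF
  have e : singleEdge.E := ()
  refine false_of_stretched n m hC hn.le i singleEdge_good e F hr hF (k := 1) ?_
    (by rwa [one_mul])
  refine le_trans (le_of_eq ?_) (hF _ _).1
  rw [gd_blockLift singleEdge_good laaksoGraded, singleEdge_good.gd_ends]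
  push_cast
  ring

end EdgeGraph

/-- The Laakso graphs do not admit uniformly bilipschitz embeddings into the diamond graphs,
whichever of the two normalizations is used for either family. -/
theorem theorem1 (ν μ : Normalization) :
    ¬ AdmitsUniformlyBilipschitzEmbeddings (Laakso ν) (Diamond μ) := by
  rintro ⟨m, f, hf, B, hB⟩
  -- The distortion is an infimum; passing to `B + 1` gives an actual constant without showing that
  -- it is attained.
  have hlt : ∀ n, ∃ C, IsBilipschitzWith C (f n) ∧ C < B + 1 := fun n =>
    exists_lt_of_csInf_lt (hf n) ((hB n).trans_lt (lt_add_one B))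
  have hB1 : 1 ≤ B + 1 := by
    obtain ⟨C, hC, hlt⟩ := hlt 0
    exact hC.1.trans hlt.le
  obtain ⟨n, hn⟩ := EdgeGraph.exists_laaksoGraph_not_bilipschitz hB1
  obtain ⟨C, ⟨-, r, hr, hrf⟩, hCB⟩ := hlt n
  have ha := edgeLength_pos four_pos n ν
  have hb := edgeLength_pos two_pos (m n) μ
  -- Edge lengths only rescale both metrics, and `r` absorbs their quotient.
  refine hn (m n) (f n) (r * edgeLength 4 n ν / edgeLength 2 (m n) μ) (by positivity)
    fun z z' => ?_
  obtain ⟨h1, h2⟩ : r * (edgeLength 4 n ν * (laaksoGraph n).gd z z') ≤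
        edgeLength 2 (m n) μ * (diamondGraph (m n)).gd (f n z) (f n z') ∧
      edgeLength 2 (m n) μ * (diamondGraph (m n)).gd (f n z) (f n z') ≤
        r * C * (edgeLength 4 n ν * (laaksoGraph n).gd z z') := hrf z z'
  have hgd : 0 ≤ (laaksoGraph n).gd z z' := Nat.cast_nonneg _
  constructor
  · rw [div_mul_eq_mul_div, div_le_iff₀ hb]
    linarith
  · rw [div_mul_eq_mul_div, div_mul_eq_mul_div, le_div_iff₀ hb]
    have h3 : r * C * (edgeLength 4 n ν * (laaksoGraph n).gd z z') ≤
        r * (B + 1) * (edgeLength 4 n ν * (laaksoGraph n).gd z z') :=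
      mul_le_mul_of_nonneg_right (mul_le_mul_of_nonneg_left hCB.le hr.le)
        (mul_nonneg ha.le hgd)
    linarith
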